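/- Let $T>0$, $I=[0,T]$, $1<p<\infty$ and $\frac1p<\gamma\le 1$. **Notation.** For a probability space $(\Omega,\mathcal F,\mathbb P)$ and a separable metric space $(X,d)$, a random probability measure $\mu\in P_\Omega(X)$ is a family $(\mu^\omega)_{\omega\in\Omega}$ of Borel measures on $X$ such that $\omega\mapsto\mu^\omega(A)$ is measurable for every Borel set $A$ and $\mu^\omega$ is a probability measure for $\mathbb P$-a.e. $\omega$. $P_p(X)$ is the set of Borel probability measures $\mu$ with $\int d(x,\bar x)^p\,\mathrm d\mu<\infty$ for some $\bar x$, with the Wasserstein distance $W_p$; $\mathrm{OptCpl}(\mu,\nu)$ is the set of couplings of $\mu,\nu$ that minimize $\int d(x,y)^p\,\mathrm d\Upsilon$ among all couplings. $P_{p,\Omega}(X)$ is the set of $\mu\in P_\Omega(X)$ with $\mathbb E\int d(x,\bar x)^p\,\mathrm d\mu<\infty$ for some $\bar x$, with the distance $$\mathbb W_p(\mu,\nu)=\Big(\inf_{\Upsilon}\mathbb E\Big[\int d(x,y)^p\,\mathrm d\Upsilon(x,y)\Big]\Big)^{1/p},$$ the infimum being over all $\Upsilon\in P_\Omega(X^2)$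 such that $\Upsilon^\omega$ is a coupling of $\mu^\omega$ and $\nu^\omega$ for $\mathbb P$-a.e. $\omega$. For a curve $x$ on $I$ in a space with distance $d$ put $$|x|_{\theta\text{-Höl}}=\sup_{0\le u<v\le T}\frac{d(x_u,x_v)}{|v-u|^\theta},\qquad |x|_{W^{\alpha,p}}=\Big(\iint_{[0,T]^2}\frac{d(x_u,x_v)^p}{|v-u|^{1+\alpha p}}\,\mathrm du\,\mathrm dv\Big)^{1/p};$$ $C^{\theta\text{-Höl}}$ and $W^{\alpha,p}$ are the sets of continuous, respectively measurable, curves for which these are finite. They are written $\|\cdot\|$ when $d=\mathbb W_p$. $C(I;\mathbb R)$ carries the supremum topology and its Borel $\sigma$-algebra, and $e_t(x)=x_t$. For $\mu\in P(\mathbb R)$, $F_\mu$ is its distribution function and $F_\mu^{-1}(q)=\inf\{x: F_\mu(x)\ge q\}$. **Statement.** For each $\alpha\in(\frac1p,\gamma)$ there is a constant $c=c(\gamma,\alpha,p,T)>0$, depending only on $\gamma,\alpha,p,T$, such that the following holds. Let $(\Omega,\mathcal F,\mathbb P)$ be a probability space and let $(\mu_t)_{t\in I}\in C^{\gamma\text{-Höl}}(I;P_{p,\Omega}(\mathbb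 R))$ (with respect to $\mathbb W_p$). Write $F_t^\omega$ for the distribution function of $\mu_t^\omega$. Then there is a random probability measure $\pi\in P_\Omega(C(I;\mathbb R))$, the same for all $\alpha$, such that for every finite sequence $t_1,\dots,t_j\in I$ $$(e_{t_1},\dots,e_{t_j})_\#\pi^\omega=\big((F_{t_1}^\omega)^{-1},\dots,(F_{t_j}^\omega)^{-1}\big)_\#\mathrm{Leb}|_{[0,1]}\qquad\text{for }\mathbb P\text{-a.e. }\omega,$$ and moreover: 1. for every $\alpha\in(\frac1p,\gamma)$, for $\mathbb P$-a.e. $\omega$: $\pi^\omega$-a.e. path belongs to $W^{\alpha,p}(I;\mathbb R)$ and to $C^{(\alpha-\frac1p)\text{-Höl}}(I;\mathbb R)$, and the curve $t\mapsto(e_t)_\#\pi^\omega$ belongs to $W^{\alpha,p}(I;P_p(\mathbb R))$ and to $C^{(\alpha-\frac1p)\text{-Höl}}(I;P_p(\mathbb R))$ (with respect to $W_p$); 2. for every $t\in I$: $(e_t)_\#\pi^\omega=\mu_t^\omega$ for $\mathbb P$-a.e. $\omega$; 3. for all $s,t\in I$: $(e_s,e_t)_\#\pi^\omega\in\mathrm{OptCpl}(\mu_s^\omega,\mu_t^\omega)$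 for $\mathbb P$-a.e. $\omega$; and for every $\alpha\in(\frac1p,\gamma)$ $$\|\mu\|_{W^{\alpha,p}}^p=\mathbb E\Big[\int_{C(I;\mathbb R)}|x|_{W^{\alpha,p}}^p\,\mathrm d\pi(x)\Big],$$ $$\|\mu\|_{\gamma\text{-Höl}}^p\ \ge\ c\,\mathbb E\Big[\int_{C(I;\mathbb R)}|x|_{(\alpha-\frac1p)\text{-Höl}}^p\,\mathrm d\pi(x)\Big]\ \ge\ c\,\|\mu\|_{(\alpha-\frac1p)\text{-Höl}}^p .$$ -/

import Mathlib

open MeasureTheory ProbabilityTheory Set Filter Topology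
open scoped ENNReal

universe u

noncomputable section

namespace QuantileLift

/-! ### Path regularity

Curves are indexed by the time interval `I = [0,T]`. The regularity of a curve `x : I → E` is measured
through a distance `d : E → E → ℝ≥0∞`, so that the same definitions serve for real paths (`d = edist`),
for curves of probability measures (`d` the Wasserstein distance) and for curves of random probability
measures (`d` its averaged version). -/

/-- The time interval `I = [0,T]`. -/
abbrev TimeInterval (T : ℝ) : Type := Set.Icc (0 : ℝ) T

/-- Lebesgue measure on `[0,T]`. -/
def timeMeasure (T : ℝ) : Measure (TimeInterval T) := (volume : Measure ℝ).comap Subtype.val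

/-- The Hölder seminorm `sup_{u < v} d(x_u, x_v) / |v - u|^θ` of a curve on `[0,T]`. -/
def holderSeminorm {E : Type*} {T : ℝ} (d : E → E → ℝ≥0∞) (θ : ℝ) (x : TimeInterval T → E) : ℝ≥0∞ :=
  ⨆ (u : TimeInterval T) (v : TimeInterval T) (_ : u < v),
    d (x u) (x v) / ENNReal.ofReal (|(v : ℝ) - (u : ℝ)| ^ θ)

/-- The fractional Sobolev seminorm
`(∬_{[0,T]²} d(x_u, x_v)^p / |v - u|^(1 + α p) du dv)^(1/p)` of a curve on `[0,T]`. -/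
def sobolevSeminorm {E : Type*} {T : ℝ} (d : E → E → ℝ≥0∞) (α p : ℝ) (x : TimeInterval T → E) : ℝ≥0∞ :=
  (∫⁻ z : TimeInterval T × TimeInterval T,
    d (x z.1) (x z.2) ^ p / ENNReal.ofReal (|(z.2 : ℝ) - (z.1 : ℝ)| ^ (1 + α * p))
      ∂((timeMeasure T).prod (timeMeasure T))) ^ (1 / p)

/-! ### The path space -/

/-- The space `C([0,T]; ℝ)` of continuous paths with the supremum topology. -/
abbrev PathSpace (T : ℝ) : Type := C(TimeInterval T, ℝ)

/-- The path space carries its Borel σ-algebra. -/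
instance instMeasurableSpacePathSpace (T : ℝ) : MeasurableSpace (PathSpace T) := borel _

instance instBorelSpacePathSpace (T : ℝ) : BorelSpace (PathSpace T) := ⟨rfl⟩

/-! ### Couplings and the Wasserstein distance -/

section Deterministic

variable {X : Type*} [MeasurableSpace X]

/-- `Υ ∈ Cpl(μ, ν)`: a probability measure on `X × X` with marginals `μ` and `ν`. -/
structure IsCoupling (Υ : Measure (X × X)) (μ ν : Measure X) : Prop where
  isProbabilityMeasure : IsProbabilityMeasure Υ
  map_fst : Υ.map Prod.fst = μ
  map_snd : Υ.map Prod.snd = ν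

variable [PseudoEMetricSpace X]

/-- The transport cost `∫ d(x,y)^p dΥ(x,y)`. -/
def transportCost (p : ℝ) (Υ : Measure (X × X)) : ℝ≥0∞ :=
  ∫⁻ z, edist z.1 z.2 ^ p ∂Υ

/-- `P_p(X)`: Borel probability measures with finite `p`-th moment. -/
def MemPp (p : ℝ) (μ : Measure X) : Prop :=
  IsProbabilityMeasure μ ∧ ∃ x₀ : X, ∫⁻ x, edist x x₀ ^ p ∂μ < ∞

/-- The `p`-Wasserstein distance `W_p`. -/
def wasserstein (p : ℝ) (μ ν : Measure X) : ℝ≥0∞ :=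
  (⨅ (Υ : Measure (X × X)) (_ : IsCoupling Υ μ ν), transportCost p Υ) ^ (1 / p)

/-- `Υ ∈ OptCpl(μ, ν)`: a coupling that attains the `p`-Wasserstein distance. -/
def IsOptCoupling (p : ℝ) (Υ : Measure (X × X)) (μ ν : Measure X) : Prop :=
  IsCoupling Υ μ ν ∧
    ∀ Υ' : Measure (X × X), IsCoupling Υ' μ ν → transportCost p Υ ≤ transportCost p Υ'

/-- `C^{θ-Höl}(I; P_p(X))`. -/
def MemHolderPp {T : ℝ} (θ p : ℝ) (ν : TimeInterval T → Measure X) : Prop :=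
  (∀ t, MemPp p (ν t)) ∧
  (∀ t, Tendsto (fun s => wasserstein p (ν s) (ν t)) (𝓝 t) (𝓝 0)) ∧
  holderSeminorm (wasserstein p) θ ν < ∞

/-- `W^{α,p}(I; P_p(X))`. Measurability of the curve is with respect to the σ-algebra generated by the
evaluations `μ ↦ μ A`, which on `P_p(X)` is the Borel σ-algebra of `W_p` when `X` is Polish. -/
def MemSobolevPp {T : ℝ} (α p : ℝ) (ν : TimeInterval T → Measure X) : Prop :=
  (∀ t, MemPp p (ν t)) ∧ Measurable ν ∧ sobolevSeminorm (wasserstein p) α p ν < ∞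

end Deterministic

/-! ### Random probability measures -/

section Random

variable {Ω : Type*} [MeasurableSpace Ω] {X : Type*} [MeasurableSpace X]

/-- `μ ∈ P_Ω(X)`: `ω ↦ μ^ω(A)` is measurable for every measurable `A`, and `μ^ω` is a probability
measure for almost every `ω`. -/
def IsRandomProb (P : Measure Ω) (μ : Ω → Measure X) : Prop :=
  Measurable μ ∧ ∀ᵐ ω ∂P, IsProbabilityMeasure (μ ω)

/-- `Υ ∈ Cpl_Ω(μ, ν)`. -/
def IsRandomCoupling (P : Measure Ω) (Υ : Ω → Measure (X × X)) (μ ν : Ω → Measure X) : Prop :=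
  IsRandomProb P Υ ∧ ∀ᵐ ω ∂P, IsCoupling (Υ ω) (μ ω) (ν ω)

variable [PseudoEMetricSpace X]

/-- `μ ∈ P_{p,Ω}(X)`: the `p`-th moment is finite in expectation. -/
def MemPpΩ (P : Measure Ω) (p : ℝ) (μ : Ω → Measure X) : Prop :=
  IsRandomProb P μ ∧ ∃ x₀ : X, ∫⁻ ω, ∫⁻ x, edist x x₀ ^ p ∂(μ ω) ∂P < ∞

/-- The distance `𝕎_p(μ, ν) = (inf_{Υ ∈ Cpl_Ω(μ,ν)} 𝔼[∫ d(x,y)^p dΥ])^(1/p)`. -/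
def randomWasserstein (P : Measure Ω) (p : ℝ) (μ ν : Ω → Measure X) : ℝ≥0∞ :=
  (⨅ (Υ : Ω → Measure (X × X)) (_ : IsRandomCoupling P Υ μ ν),
    ∫⁻ ω, transportCost p (Υ ω) ∂P) ^ (1 / p)

/-- `C^{θ-Höl}(I; P_{p,Ω}(X))`. -/
def MemHolderPpΩ {T : ℝ} (P : Measure Ω) (θ p : ℝ) (μ : TimeInterval T → Ω → Measure X) : Prop :=
  (∀ t, MemPpΩ P p (μ t)) ∧
  (∀ t, Tendsto (fun s => randomWasserstein P p (μ s) (μ t)) (𝓝 t) (𝓝 0)) ∧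
  holderSeminorm (randomWasserstein P p) θ μ < ∞

end Random

/-- The generalized (left-continuous) inverse `F_μ⁻¹(q) = inf {x | F_μ(x) ≥ q}` of the cumulative
distribution function of `μ`. It is real for `0 < q < 1`; the values at `0` and `1`, where the infimum
may be infinite, are irrelevant for integration against Lebesgue measure. -/
def quantile (μ : Measure ℝ) (q : ℝ) : ℝ := sInf {x : ℝ | q ≤ cdf μ x}

end QuantileLift

end

namespace QuantileLift

/-! ### Quantile functions -/

/-! Regard `X_t(ω, q) = (F_t^ω)⁻¹(q)` as a stochastic process on `Ω × [0,1]` under `P ⊗ Leb`. On the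
line the monotone (quantile) coupling is optimal for `|x - y|^p`, and it depends measurably on `ω`.
Coupling fibre by fibre therefore attains the infimum in `𝕎_p`, so that `𝕎_p(μ_s, μ_t)` is the
`L^p(P ⊗ Leb)` distance of `X_s` and `X_t` (`isOptCoupling_quantileCoupling`,
`randomWasserstein_eq`).

Thus Hölder continuity of `μ` with exponent `κ` (the `γ` of the statement) is the moment hypothesis
of Kolmogorov's continuity theorem. As `κ > 1/p`, dyadic chaining gives a modification `Y` with
continuous paths, whose Hölder seminorms of exponent below `κ - 1/p` have finite `p`-th moment
(`exists_continuous_modification`). The lift `π^ω` is the law of `q ↦ Y(ω, q)`.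

Marginals and optimality follow from `Y_t = X_t` a.e. at each fixed time. The Sobolev identity is
Tonelli's theorem applied to `𝕎_p(μ_s, μ_t)^p = 𝔼|Y_s - Y_t|^p`; the energy is finite because `α <
κ`. For Hölder seminorms a supremum has to pass through an integral, which leaves only an
inequality.

Optimality of the monotone coupling is proved without cyclical monotonicity: `|x - y|^p` is a
positive superposition of indicators of crossing events, and the monotone coupling minimizes the
probability of each of them. -/

theorem quantile_le_iff (μ : Measure ℝ) {q x : ℝ} (hq : q ∈ Ioo (0 : ℝ) 1) :
    quantile μ q ≤ x ↔ q ≤ cdf μ x := by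
  set S : Set ℝ := {x : ℝ | q ≤ cdf μ x} with hS
  have hne : S.Nonempty :=
    (((tendsto_cdf_atTop μ).eventually (lt_mem_nhds hq.2)).exists).imp fun _ h => h.le
  obtain ⟨b, hb⟩ := ((tendsto_cdf_atBot μ).eventually (gt_mem_nhds hq.1)).exists
  have hbdd : BddBelow S := by
    refine ⟨b, fun y hy => ?_⟩
    by_contra! h
    exact absurd (hy.trans (monotone_cdf μ h.le)) (not_le.2 hb)
  have hmem : sInf S ∈ S := by
    have hcont : Tendsto (cdf μ) (𝓝[>] (sInf S)) (𝓝 (cdf μ (sInf S))) :=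
      ((cdf μ).right_continuous (sInf S)).mono_left (nhdsWithin_mono _ Ioi_subset_Ici_self)
    refine ge_of_tendsto hcont ?_
    filter_upwards [self_mem_nhdsWithin] with y hy
    obtain ⟨z, hz, hzy⟩ := (csInf_lt_iff hbdd hne).1 hy
    exact hz.trans (monotone_cdf μ hzy.le)
  constructor
  · intro h
    exact hmem.trans (monotone_cdf μ h)
  · intro h
    exact csInf_le hbdd h

/-- Lebesgue measure on `[0,1]`. -/
noncomputable abbrev unitMeasure : Measure ℝ := volume.restrict (Icc (0 : ℝ) 1)

instance : IsProbabilityMeasure unitMeasure := ⟨by simp⟩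

theorem ae_unitMeasure_mem_Ioo : ∀ᵐ q ∂unitMeasure, q ∈ Ioo (0 : ℝ) 1 := by
  have : unitMeasure = volume.restrict (Ioo (0 : ℝ) 1) :=
    (Measure.restrict_congr_set Ioo_ae_eq_Icc).symm
  rw [this]
  exact ae_restrict_mem measurableSet_Ioo

/-- A jointly measurable version of `(ω, q) ↦ quantile (μ ω) q`. -/
noncomputable def quantileVersion {Ω : Type*} (μ : Ω → Measure ℝ) (z : Ω × ℝ) : ℝ :=
  open Classical in if z.2 ∈ Ioo (0 : ℝ) 1 ∧ μ z.1 univ = 1 then quantile (μ z.1) z.2 else 0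

theorem measurable_quantileVersion {Ω : Type*} [MeasurableSpace Ω] {μ : Ω → Measure ℝ} (hμ : Measurable μ) :
    Measurable (quantileVersion μ) := by
  have hm : ∀ {s : Set ℝ}, MeasurableSet s → Measurable fun z : Ω × ℝ => μ z.1 s := fun hs =>
    (Measure.measurable_coe hs).comp (hμ.comp measurable_fst)
  have hA : MeasurableSet {z : Ω × ℝ | z.2 ∈ Ioo (0 : ℝ) 1 ∧ μ z.1 univ = 1} :=
    (measurable_snd measurableSet_Ioo).inter
      (hm MeasurableSet.univ (measurableSet_singleton 1))
  refine measurable_of_Iic fun x => ?_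
  -- By `quantile_le_iff`, sublevel sets of the quantile are described by `q ≤ μ^ω(-∞, x]`, which is
  -- jointly measurable in `(ω, q)`.
  have hB : MeasurableSet {z : Ω × ℝ | ENNReal.ofReal z.2 ≤ μ z.1 (Iic x)} :=
    measurableSet_le (ENNReal.measurable_ofReal.comp measurable_snd) (hm measurableSet_Iic)
  convert! (hA.inter hB).union (hA.compl.inter (MeasurableSet.const (0 ≤ x))) using 1
  ext z
  by_cases h : z.2 ∈ Ioo (0 : ℝ) 1 ∧ μ z.1 univ = 1
  · have : IsProbabilityMeasure (μ z.1) := ⟨h.2⟩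
    have h0 := cdf_nonneg (μ z.1) x
    simp only [quantileVersion, mem_preimage, mem_Iic, mem_union,
      mem_inter_iff, mem_ofPred_eq, h, true_and, mem_compl_iff, not_true, false_and, or_false,
      if_true, quantile_le_iff _ h.1]
    rw [← ofReal_cdf, ENNReal.ofReal_le_ofReal_iff h0]
  · simp only [quantileVersion, mem_preimage, mem_Iic, mem_union,
      mem_inter_iff, mem_ofPred_eq, h, false_and, mem_compl_iff, not_false_iff, true_and, false_or,
      if_false]

theorem quantileVersion_ae_eq {Ω : Type*} (μ : Ω → Measure ℝ) {ω : Ω} (hω : IsProbabilityMeasure (μ ω)) :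
    (fun q => quantileVersion μ (ω, q)) =ᵐ[unitMeasure] quantile (μ ω) := by
  filter_upwards [ae_unitMeasure_mem_Ioo] with q hq
  exact if_pos ⟨hq, hω.measure_univ⟩

theorem aemeasurable_quantile (μ : Measure ℝ) [h : IsProbabilityMeasure μ] :
    AEMeasurable (quantile μ) unitMeasure :=
  ⟨fun q => quantileVersion (fun _ : Unit => μ) ((), q),
    (measurable_quantileVersion measurable_const).comp measurable_prodMk_left,
    (quantileVersion_ae_eq (fun _ : Unit => μ) (ω := ()) h).symm⟩

theorem map_quantile (μ : Measure ℝ) [IsProbabilityMeasure μ] :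
    unitMeasure.map (quantile μ) = μ := by
  have : IsProbabilityMeasure (unitMeasure.map (quantile μ)) :=
    Measure.isProbabilityMeasure_map (aemeasurable_quantile μ)
  refine Measure.ext_of_Iic _ _ fun x => ?_
  rw [Measure.map_apply_of_aemeasurable (aemeasurable_quantile μ) measurableSet_Iic, ← ofReal_cdf]
  have : quantile μ ⁻¹' Iic x =ᵐ[unitMeasure] Iic (cdf μ x) := by
    filter_upwards [ae_unitMeasure_mem_Ioo] with q hq
    exact propext (quantile_le_iff μ hq)
  have h2 : Iic (cdf μ x) ∩ Icc (0 : ℝ) 1 = Icc 0 (cdf μ x) := by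
    ext q
    simp only [mem_inter_iff, mem_Iic, mem_Icc]
    have := cdf_le_one μ x
    constructor
    · tauto
    · rintro ⟨h, h'⟩
      exact ⟨h', h, h'.trans this⟩
  rw [measure_congr this, Measure.restrict_apply measurableSet_Iic, h2]
  simp

/-- The monotone coupling of `μ` and `ν`. -/
noncomputable def quantileCoupling (μ ν : Measure ℝ) : Measure (ℝ × ℝ) :=
  unitMeasure.map fun q => (quantile μ q, quantile ν q)

theorem isCoupling_quantileCoupling (μ ν : Measure ℝ) [IsProbabilityMeasure μ]
    [IsProbabilityMeasure ν] : IsCoupling (quantileCoupling μ ν) μ ν := by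
  have h := (aemeasurable_quantile μ).prodMk (aemeasurable_quantile ν)
  refine ⟨Measure.isProbabilityMeasure_map h, ?_, ?_⟩
  · rw [quantileCoupling, AEMeasurable.map_map_of_aemeasurable measurable_fst.aemeasurable h]
    exact map_quantile μ
  · rw [quantileCoupling, AEMeasurable.map_map_of_aemeasurable measurable_snd.aemeasurable h]
    exact map_quantile ν

/-! ### Optimality of the monotone coupling -/

/-- Writes `d ^ p` as a mixture of the hinge functions `(d - r)₊`, the truncation being done by
`ENNReal.ofReal`. The weight `r ^ (p - 2)` is proportional to the second derivative of `r ^ p`, and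
`p > 1` makes it integrable at `0`. -/
theorem lintegral_rpow_mul_sub {p d : ℝ} (hp : 1 < p) (hd : 0 ≤ d) :
    ∫⁻ r in Ioi (0 : ℝ), ENNReal.ofReal (r ^ (p - 2)) * ENNReal.ofReal (d - r) =
      ENNReal.ofReal (d ^ p) * ENNReal.ofReal (1 / (p - 1) - 1 / p) := by
  have hint1 : IntervalIntegrable (fun r : ℝ => r ^ (p - 2) * d) volume 0 d :=
    (intervalIntegral.intervalIntegrable_rpow' (by linarith)).mul_const d
  have hint2 : IntervalIntegrable (fun r : ℝ => r ^ (p - 1)) volume 0 d :=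
    intervalIntegral.intervalIntegrable_rpow' (by linarith)
  have hint : IntervalIntegrable (fun r : ℝ => r ^ (p - 2) * d - r ^ (p - 1)) volume 0 d :=
    hint1.sub hint2
  have hfun : ∀ r ∈ Ioc 0 d, r ^ (p - 2) * d - r ^ (p - 1) = r ^ (p - 2) * (d - r) := by
    intro r hr
    have : r ^ (p - 1) = r ^ (p - 2) * r := by
      rw [← Real.rpow_add_one hr.1.ne']; ring_nf
    rw [this]; ring
  have hval : ∫ r in (0 : ℝ)..d, (r ^ (p - 2) * d - r ^ (p - 1)) =
      d ^ p * (1 / (p - 1) - 1 / p) := by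
    rw [intervalIntegral.integral_sub hint1 hint2, intervalIntegral.integral_mul_const,
      integral_rpow (Or.inl (by linarith)), integral_rpow (Or.inl (by linarith))]
    have e1 : p - 2 + 1 = p - 1 := by ring
    have e2 : p - 1 + 1 = p := by ring
    rw [e1, e2, Real.zero_rpow (by linarith), Real.zero_rpow (by linarith)]
    rcases hd.eq_or_lt with rfl | hd'
    · rw [Real.zero_rpow (by linarith), Real.zero_rpow (by linarith)]; simp
    · have : d ^ p = d ^ (p - 1) * d := by rw [← Real.rpow_add_one hd'.ne']; ring_nf
      rw [this]; ring
  rw [← ENNReal.ofReal_mul (by positivity), ← hval, intervalIntegral.integral_of_le hd,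
    ofReal_integral_eq_lintegral_ofReal hint.1]
  · rw [← Ioc_union_Ioi_eq_Ioi hd, lintegral_union measurableSet_Ioi
      (Set.Ioc_disjoint_Ioi le_rfl), setLIntegral_congr_fun (g := fun _ => 0) measurableSet_Ioi,
      lintegral_zero, add_zero]
    · refine setLIntegral_congr_fun measurableSet_Ioc fun r hr => ?_
      rw [hfun r hr, ENNReal.ofReal_mul (Real.rpow_nonneg hr.1.le _)]
    · intro r hr
      have : d - r ≤ 0 := by simpa using (mem_Ioi.1 hr).le
      simp [ENNReal.ofReal_of_nonpos this]
  · filter_upwards [ae_restrict_mem measurableSet_Ioc] with r hr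
    rw [hfun r hr]
    exact mul_nonneg (Real.rpow_nonneg hr.1.le _) (by linarith [hr.2])

/-- Pairs `(x, y)` with `y ≤ s` and `s + r < x`. -/
def crossing (r s : ℝ) : Set (ℝ × ℝ) := {z | z.2 ≤ s ∧ s + r < z.1}

theorem measurableSet_crossing (r s : ℝ) : MeasurableSet (crossing r s) :=
  (measurableSet_le measurable_snd measurable_const).inter
    (measurableSet_lt measurable_const measurable_fst)

theorem measurableSet_crossing_prod :
    MeasurableSet {w : (ℝ × ℝ) × (ℝ × ℝ) | w.1 ∈ crossing w.2.1 w.2.2} := by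
  have h1 : MeasurableSet {w : (ℝ × ℝ) × (ℝ × ℝ) | w.1.2 ≤ w.2.2} :=
    measurableSet_le (by fun_prop) (by fun_prop)
  have h2 : MeasurableSet {w : (ℝ × ℝ) × (ℝ × ℝ) | w.2.2 + w.2.1 < w.1.1} :=
    measurableSet_lt (by fun_prop) (by fun_prop)
  exact h1.inter h2

/-- The levels `s` crossed by `z` form the interval `[z.2, z.1 - r)`, whose length is the hinge
function. -/
theorem lintegral_indicator_crossing (r : ℝ) (z : ℝ × ℝ) :
    ∫⁻ s, (crossing r s).indicator 1 z = ENNReal.ofReal (z.1 - z.2 - r) := by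
  have : ∀ s, (crossing r s).indicator (1 : ℝ × ℝ → ℝ≥0∞) z =
      (Ico z.2 (z.1 - r)).indicator (fun _ => 1) s := by
    intro s
    simp only [indicator, crossing, mem_ofPred_eq, mem_Ico, lt_sub_iff_add_lt, Pi.one_apply]
    congr
  simp_rw [this]
  rw [lintegral_indicator measurableSet_Ico]
  simp
  ring_nf

theorem edist_rpow_eq_lintegral {p : ℝ} (hp : 1 < p) (z : ℝ × ℝ) :
    edist z.1 z.2 ^ p * ENNReal.ofReal (1 / (p - 1) - 1 / p) =
      ∫⁻ w : ℝ × ℝ, ENNReal.ofReal (w.1 ^ (p - 2)) *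
        ((crossing w.1 w.2).indicator 1 z + (crossing w.1 w.2).indicator 1 z.swap)
        ∂((volume.restrict (Ioi (0 : ℝ))).prod volume) := by
  have hm : ∀ y : ℝ × ℝ, Measurable fun w : ℝ × ℝ =>
      (crossing w.1 w.2).indicator (1 : ℝ × ℝ → ℝ≥0∞) y := fun y =>
    (measurable_const.indicator measurableSet_crossing_prod).comp
      (measurable_prodMk_left (x := y))
  have hw : Measurable fun w : ℝ × ℝ => ENNReal.ofReal (w.1 ^ (p - 2)) := by fun_prop
  rw [lintegral_prod _ (hw.fun_mul ((hm z).fun_add (hm z.swap))).aemeasurable, edist_dist,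
    ENNReal.ofReal_rpow_of_nonneg dist_nonneg (by linarith),
    ← lintegral_rpow_mul_sub hp dist_nonneg]
  refine setLIntegral_congr_fun measurableSet_Ioi fun r hr => ?_
  have hr' : 0 < r := hr
  dsimp only
  have hm' : ∀ y : ℝ × ℝ, Measurable fun s : ℝ =>
      (crossing r s).indicator (1 : ℝ × ℝ → ℝ≥0∞) y := fun y =>
    (hm y).comp measurable_prodMk_left
  rw [lintegral_const_mul _ ((hm' z).fun_add (hm' z.swap)), lintegral_add_left (hm' z), lintegral_indicator_crossing,
    lintegral_indicator_crossing, Real.dist_eq, Prod.fst_swap, Prod.snd_swap]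
  congr 1
  rcases le_total z.1 z.2 with h | h
  · rw [abs_of_nonpos (by linarith), ENNReal.ofReal_of_nonpos (p := z.1 - z.2 - r) (by linarith)]
    simp
  · rw [abs_of_nonneg (by linarith), ENNReal.ofReal_of_nonpos (p := z.2 - z.1 - r) (by linarith)]
    simp

/-- By Tonelli the cost is a positive mixture of crossing probabilities in both directions, so a
coupling that minimizes each of these is optimal. -/
theorem transportCost_eq_lintegral {p : ℝ} (hp : 1 < p) (Υ : Measure (ℝ × ℝ)) [SFinite Υ] :
    transportCost p Υ * ENNReal.ofReal (1 / (p - 1) - 1 / p) =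
      ∫⁻ w : ℝ × ℝ, ENNReal.ofReal (w.1 ^ (p - 2)) *
        (Υ (crossing w.1 w.2) + Υ (Prod.swap ⁻¹' crossing w.1 w.2))
        ∂((volume.restrict (Ioi (0 : ℝ))).prod volume) := by
  have hF : Measurable fun v : (ℝ × ℝ) × (ℝ × ℝ) =>
      (crossing v.2.1 v.2.2).indicator (1 : ℝ × ℝ → ℝ≥0∞) v.1 :=
    measurable_const.indicator measurableSet_crossing_prod
  have hG : Measurable fun v : (ℝ × ℝ) × (ℝ × ℝ) =>
      (crossing v.2.1 v.2.2).indicator (1 : ℝ × ℝ → ℝ≥0∞) v.1.swap :=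
    hF.comp (f := fun v : (ℝ × ℝ) × (ℝ × ℝ) => (v.1.swap, v.2)) (by fun_prop)
  have hw : Measurable fun v : (ℝ × ℝ) × (ℝ × ℝ) => ENNReal.ofReal (v.2.1 ^ (p - 2)) := by fun_prop
  rw [transportCost, ← lintegral_mul_const' _ _ ENNReal.ofReal_ne_top]
  simp_rw [edist_rpow_eq_lintegral hp]
  rw [lintegral_lintegral_swap (hw.fun_mul (hF.fun_add hG)).aemeasurable]
  refine lintegral_congr fun w => ?_
  have h1 : Measurable fun z : ℝ × ℝ => (crossing w.1 w.2).indicator (1 : ℝ × ℝ → ℝ≥0∞) z :=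
    measurable_const.indicator (measurableSet_crossing _ _)
  have h2 : Measurable fun z : ℝ × ℝ => (crossing w.1 w.2).indicator (1 : ℝ × ℝ → ℝ≥0∞) z.swap :=
    h1.comp measurable_swap
  rw [lintegral_const_mul _ (h1.fun_add h2), lintegral_add_left h1,
    lintegral_indicator_one (measurableSet_crossing _ _)]
  have h3 : (fun z : ℝ × ℝ => (crossing w.1 w.2).indicator (1 : ℝ × ℝ → ℝ≥0∞) z.swap) =
      (Prod.swap ⁻¹' crossing w.1 w.2).indicator 1 := rfl
  rw [h3, lintegral_indicator_one (measurable_swap (measurableSet_crossing _ _))]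

/-- The lower bound involves only the marginals: if `y ≤ s`, then either `x > s + r` or `x ≤ s + r`.
-/
theorem IsCoupling.sub_le_crossing {Υ : Measure (ℝ × ℝ)} {μ ν : Measure ℝ}
    (h : IsCoupling Υ μ ν) (r s : ℝ) : ν (Iic s) - μ (Iic (s + r)) ≤ Υ (crossing r s) := by
  rw [tsub_le_iff_right, ← h.map_fst, ← h.map_snd, Measure.map_apply measurable_fst measurableSet_Iic,
    Measure.map_apply measurable_snd measurableSet_Iic]
  refine (measure_mono fun z hz => ?_).trans (measure_union_le _ _)
  rcases lt_or_ge (s + r) z.1 with h1 | h1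
  · exact Or.inl ⟨hz, h1⟩
  · exact Or.inr h1

theorem IsCoupling.swap {X : Type*} [MeasurableSpace X] {Υ : Measure (X × X)} {μ ν : Measure X}
    (h : IsCoupling Υ μ ν) : IsCoupling (Υ.map Prod.swap) ν μ := by
  have := h.isProbabilityMeasure
  refine ⟨Measure.isProbabilityMeasure_map measurable_swap.aemeasurable, ?_, ?_⟩
  · rw [Measure.map_map measurable_fst measurable_swap]; exact h.map_snd
  · rw [Measure.map_map measurable_snd measurable_swap]; exact h.map_fst

/-- Under the monotone coupling a crossing means `F_μ(s + r) < q ≤ F_ν(s)`, an interval whose length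
is exactly the universal lower bound of `IsCoupling.sub_le_crossing`. -/
theorem quantileCoupling_crossing_le (μ ν : Measure ℝ) [IsProbabilityMeasure μ]
    [IsProbabilityMeasure ν] (r s : ℝ) :
    quantileCoupling μ ν (crossing r s) ≤ ν (Iic s) - μ (Iic (s + r)) := by
  have h := (aemeasurable_quantile μ).prodMk (aemeasurable_quantile ν)
  rw [quantileCoupling, Measure.map_apply_of_aemeasurable h (measurableSet_crossing r s),
    ← ofReal_cdf, ← ofReal_cdf, ← ENNReal.ofReal_sub _ (cdf_nonneg _ _), ← Real.volume_Ioc]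
  refine (measure_mono_ae ?_).trans (Measure.restrict_apply_le _ _)
  filter_upwards [ae_unitMeasure_mem_Ioo] with q hq hz
  refine ⟨?_, (quantile_le_iff ν hq).1 hz.1⟩
  by_contra! h'
  exact absurd ((quantile_le_iff μ hq).2 h') (not_le.2 hz.2)

theorem swap_quantileCoupling (μ ν : Measure ℝ) [IsProbabilityMeasure μ]
    [IsProbabilityMeasure ν] : (quantileCoupling μ ν).map Prod.swap = quantileCoupling ν μ :=
  AEMeasurable.map_map_of_aemeasurable measurable_swap.aemeasurable
    ((aemeasurable_quantile μ).prodMk (aemeasurable_quantile ν))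

theorem isOptCoupling_quantileCoupling {p : ℝ} (hp : 1 < p) (μ ν : Measure ℝ)
    [IsProbabilityMeasure μ] [IsProbabilityMeasure ν] :
    IsOptCoupling p (quantileCoupling μ ν) μ ν := by
  have hq := isCoupling_quantileCoupling μ ν
  refine ⟨hq, fun Υ hΥ => ?_⟩
  have := hΥ.isProbabilityMeasure
  have := hq.isProbabilityMeasure
  -- The constant equals `1 / (p (p - 1))`. Being positive and finite, it cancels even when the
  -- costs are infinite.
  have hc : 0 < 1 / (p - 1) - 1 / p := by
    rw [sub_pos]
    exact one_div_lt_one_div_of_lt (by linarith) (by linarith)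
  rw [← ENNReal.mul_le_mul_iff_left (ENNReal.ofReal_pos.2 hc).ne' ENNReal.ofReal_ne_top,
    transportCost_eq_lintegral hp, transportCost_eq_lintegral hp]
  refine lintegral_mono fun w => mul_le_mul_right (add_le_add ?_ ?_) _
  · exact (quantileCoupling_crossing_le μ ν _ _).trans (hΥ.sub_le_crossing _ _)
  · rw [← Measure.map_apply measurable_swap (measurableSet_crossing _ _),
      ← Measure.map_apply measurable_swap (measurableSet_crossing _ _), swap_quantileCoupling]
    exact (quantileCoupling_crossing_le ν μ _ _).trans (hΥ.swap.sub_le_crossing _ _)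

/-! ### The Hölder seminorm -/

section Holder

variable {E : Type*} {T : ℝ}

theorem le_holderSeminorm_mul_of_lt (d : E → E → ℝ≥0∞) (θ : ℝ) (x : TimeInterval T → E)
    {u v : TimeInterval T} (h : u < v) :
    d (x u) (x v) ≤ holderSeminorm d θ x * ENNReal.ofReal (|(v : ℝ) - u| ^ θ) := by
  have h0 : 0 < |(v : ℝ) - u| := abs_pos.2 (sub_ne_zero.2 (Subtype.coe_lt_coe.2 h).ne')
  rw [← ENNReal.div_le_iff (ENNReal.ofReal_pos.2 (Real.rpow_pos_of_pos h0 _)).ne'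
    ENNReal.ofReal_ne_top]
  exact le_iSup_of_le u (le_iSup_of_le v (le_iSup_of_le h le_rfl))

theorem le_holderSeminorm_mul {d : E → E → ℝ≥0∞} (θ : ℝ) {x : TimeInterval T → E}
    (hs : ∀ u v, d (x u) (x v) = d (x v) (x u)) (h0 : ∀ u, d (x u) (x u) = 0)
    (u v : TimeInterval T) :
    d (x u) (x v) ≤ holderSeminorm d θ x * ENNReal.ofReal (|(v : ℝ) - u| ^ θ) := by
  rcases lt_trichotomy u v with h | rfl | h
  · exact le_holderSeminorm_mul_of_lt d θ x h
  · simp [h0]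
  · rw [hs, abs_sub_comm]
    exact le_holderSeminorm_mul_of_lt d θ x h

theorem holderSeminorm_le {d : E → E → ℝ≥0∞} {θ : ℝ} {x : TimeInterval T → E} {C : ℝ≥0∞}
    (h : ∀ u v : TimeInterval T, u < v →
      d (x u) (x v) ≤ C * ENNReal.ofReal (|(v : ℝ) - u| ^ θ)) :
    holderSeminorm d θ x ≤ C :=
  iSup_le fun u => iSup_le fun v => iSup_le fun huv => ENNReal.div_le_of_le_mul (h u v huv)

theorem edist_le_holderSeminorm_mul (θ : ℝ) (x : TimeInterval T → ℝ) (u v : TimeInterval T) :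
    edist (x u) (x v) ≤ holderSeminorm edist θ x * ENNReal.ofReal (|(v : ℝ) - u| ^ θ) :=
  le_holderSeminorm_mul θ (fun _ _ => edist_comm _ _) (fun _ => edist_self _) u v

theorem tendsto_ofReal_abs_sub_rpow {θ : ℝ} (hθ : 0 < θ) (t : TimeInterval T) :
    Tendsto (fun s : TimeInterval T => ENNReal.ofReal (|(t : ℝ) - s| ^ θ)) (𝓝 t) (𝓝 0) := by
  have hc : Continuous fun s : TimeInterval T => ENNReal.ofReal (|(t : ℝ) - s| ^ θ) :=
    ENNReal.continuous_ofReal.comp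
      (Continuous.rpow_const (by fun_prop) fun _ => Or.inr hθ.le)
  convert! hc.tendsto t using 2
  simp [Real.zero_rpow hθ.ne']

theorem tendsto_of_le_mul_abs_sub_rpow {d : E → E → ℝ≥0∞} {θ : ℝ} (hθ : 0 < θ)
    {x : TimeInterval T → E} {C : ℝ≥0∞} (hC : C ≠ ∞)
    (h : ∀ u v, d (x u) (x v) ≤ C * ENNReal.ofReal (|(v : ℝ) - u| ^ θ)) (t : TimeInterval T) :
    Tendsto (fun s => d (x s) (x t)) (𝓝 t) (𝓝 0) := by
  refine tendsto_of_tendsto_of_tendsto_of_le_of_le tendsto_const_nhds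
    (h := fun s : TimeInterval T => C * ENNReal.ofReal (|(t : ℝ) - s| ^ θ)) ?_
    (fun _ => zero_le) fun s => h s t
  simpa using ENNReal.Tendsto.const_mul (tendsto_ofReal_abs_sub_rpow hθ t) (Or.inr hC)

theorem continuous_of_holderSeminorm_lt_top {θ : ℝ} (hθ : 0 < θ) {x : TimeInterval T → ℝ}
    (hx : holderSeminorm edist θ x < ∞) : Continuous x :=
  continuous_iff_continuousAt.2 fun t => tendsto_iff_edist_tendsto_0.2 <|
    tendsto_of_le_mul_abs_sub_rpow hθ hx.ne (edist_le_holderSeminorm_mul θ x) t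

end Holder

/-! ### Dyadic chaining -/

section Dyadic

variable {T : ℝ}

/-- The dyadic point `k T / 2^n` of `[0,T]`. -/
noncomputable def dyadicPoint (hT : 0 < T) (n k : ℕ) : TimeInterval T :=
  projIcc 0 T hT.le (T * k / 2 ^ n)

/-- The index of the largest dyadic point of level `n` that is at most `t`. -/
noncomputable def dyadicIndex (n : ℕ) (t : TimeInterval T) : ℕ := ⌊(t : ℝ) * 2 ^ n / T⌋₊

/-- The largest dyadic point of level `n` that is at most `t`. -/
noncomputable def dyadicFloor (hT : 0 < T) (n : ℕ) (t : TimeInterval T) : TimeInterval T :=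
  dyadicPoint hT n (dyadicIndex n t)

/-- The `p`-th power of a discrete Besov norm: a weighted sum over all dyadic levels of the `p`-th
powers of the increments between neighbours, with weight `r ^ (-n p)` at level `n`. -/
noncomputable def dyadicEnergy (hT : 0 < T) (p : ℝ) (r : ℝ≥0∞) (f : TimeInterval T → ℝ) : ℝ≥0∞ :=
  ∑' n : ℕ, ∑ k ∈ Finset.range (2 ^ n),
    (edist (f (dyadicPoint hT n k)) (f (dyadicPoint hT n (k + 1))) / r ^ n) ^ p

/-- The limit of `f` along the dyadic floors of `t`. -/
noncomputable def dyadicLimit (hT : 0 < T) (f : TimeInterval T → ℝ) (t : TimeInterval T) : ℝ :=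
  limUnder atTop fun n => f (dyadicFloor hT n t)

theorem coe_dyadicPoint (hT : 0 < T) {n k : ℕ} (hk : k ≤ 2 ^ n) :
    (dyadicPoint hT n k : ℝ) = T * k / 2 ^ n := by
  have hk' : (k : ℝ) ≤ 2 ^ n := by exact_mod_cast hk
  rw [dyadicPoint, projIcc_of_mem hT.le]
  refine ⟨by positivity, ?_⟩
  rw [div_le_iff₀ (by positivity)]
  gcongr

theorem dyadicPoint_succ_two_mul (hT : 0 < T) (n k : ℕ) :
    dyadicPoint hT (n + 1) (2 * k) = dyadicPoint hT n k := by
  have : T * ((2 * k : ℕ) : ℝ) / 2 ^ (n + 1) = T * k / 2 ^ n := by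
    push_cast
    field_simp
    ring
  rw [dyadicPoint, this, dyadicPoint]

theorem dyadicIndex_le (hT : 0 < T) (n : ℕ) (t : TimeInterval T) : dyadicIndex n t ≤ 2 ^ n := by
  have : (t : ℝ) * 2 ^ n / T ≤ ((2 ^ n : ℕ) : ℝ) := by
    rw [div_le_iff₀ hT, mul_comm, Nat.cast_pow, Nat.cast_ofNat]
    gcongr
    exact t.2.2
  exact Nat.floor_le_of_le this

theorem mul_two_pow_div_nonneg (hT : 0 < T) (n : ℕ) (t : TimeInterval T) :
    0 ≤ (t : ℝ) * 2 ^ n / T :=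
  div_nonneg (mul_nonneg t.2.1 (by positivity)) hT.le

/-- Hence successive dyadic floors of `t` coincide or are neighbours on the finer grid, and refining
costs at most one increment per level. -/
theorem dyadicIndex_succ (hT : 0 < T) (n : ℕ) (t : TimeInterval T) :
    dyadicIndex (n + 1) t = 2 * dyadicIndex n t ∨
      dyadicIndex (n + 1) t = 2 * dyadicIndex n t + 1 := by
  have h0 := mul_two_pow_div_nonneg hT n t
  have e : (t : ℝ) * 2 ^ (n + 1) / T = 2 * ((t : ℝ) * 2 ^ n / T) := by ring
  have h1 := Nat.floor_le h0
  have h2 := Nat.lt_floor_add_one ((t : ℝ) * 2 ^ n / T)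
  have h3 : 2 * dyadicIndex n t ≤ dyadicIndex (n + 1) t := by
    refine Nat.le_floor ?_
    rw [e, dyadicIndex]
    push_cast
    linarith
  have h4 : dyadicIndex (n + 1) t < 2 * dyadicIndex n t + 2 := by
    rw [dyadicIndex, Nat.floor_lt (mul_two_pow_div_nonneg hT _ t), e, dyadicIndex]
    push_cast
    linarith
  omega

theorem dyadicIndex_near (hT : 0 < T) {n : ℕ} {s t : TimeInterval T} (hst : s ≤ t)
    (h : (t : ℝ) - s ≤ T / 2 ^ n) :
    dyadicIndex n t = dyadicIndex n s ∨ dyadicIndex n t = dyadicIndex n s + 1 := by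
  have hst' : (s : ℝ) ≤ t := hst
  have h3 : dyadicIndex n s ≤ dyadicIndex n t := by
    refine Nat.floor_le_floor ?_
    gcongr
  have h2 := Nat.lt_floor_add_one ((s : ℝ) * 2 ^ n / T)
  have h4 : (t : ℝ) * 2 ^ n / T ≤ (s : ℝ) * 2 ^ n / T + 1 := by
    rw [le_div_iff₀ (by positivity)] at h
    rw [div_add_one hT.ne', div_le_div_iff_of_pos_right hT]
    linarith
  have h5 : dyadicIndex n t < dyadicIndex n s + 2 := by
    rw [dyadicIndex, Nat.floor_lt (mul_two_pow_div_nonneg hT _ t), dyadicIndex]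
    push_cast
    linarith
  omega

theorem abs_dyadicFloor_sub_le (hT : 0 < T) (n : ℕ) (t : TimeInterval T) :
    |(t : ℝ) - dyadicFloor hT n t| ≤ T / 2 ^ n := by
  rw [dyadicFloor, coe_dyadicPoint hT (dyadicIndex_le hT n t)]
  have h1 := Nat.floor_le (mul_two_pow_div_nonneg hT n t)
  have h2 := Nat.lt_floor_add_one ((t : ℝ) * 2 ^ n / T)
  change (dyadicIndex n t : ℝ) ≤ _ at h1
  change _ < (dyadicIndex n t : ℝ) + 1 at h2
  rw [le_div_iff₀ hT] at h1
  rw [div_lt_iff₀ hT] at h2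
  rw [abs_le]
  constructor
  · have h3 : T * (dyadicIndex n t : ℝ) / 2 ^ n ≤ t := by
      rw [div_le_iff₀ (by positivity)]
      linarith
    have h4 : 0 ≤ T / 2 ^ n := by positivity
    linarith
  · rw [sub_le_iff_le_add, ← add_div, le_div_iff₀ (by positivity)]
    linarith

/-- A single term of the energy is at most the whole sum; this turns an `ℓ^p` quantity into a
uniform bound at each level. -/
theorem edist_dyadicPoint_le (hT : 0 < T) {p : ℝ} (hp : 0 < p) {r : ℝ≥0∞} (hr : r ≠ 0)
    (hr' : r ≠ ∞) (f : TimeInterval T → ℝ) {n k : ℕ} (hk : k < 2 ^ n) :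
    edist (f (dyadicPoint hT n k)) (f (dyadicPoint hT n (k + 1))) ≤
      dyadicEnergy hT p r f ^ (1 / p) * r ^ n := by
  rw [← ENNReal.div_le_iff (pow_ne_zero _ hr) (ENNReal.pow_ne_top hr'), one_div,
    ENNReal.le_rpow_inv_iff hp]
  refine le_trans ?_ (ENNReal.le_tsum n)
  exact Finset.single_le_sum
    (f := fun k => (edist (f (dyadicPoint hT n k)) (f (dyadicPoint hT n (k + 1))) / r ^ n) ^ p)
    (fun _ _ => zero_le) (Finset.mem_range.2 hk)

theorem edist_dyadicFloor_succ_le (hT : 0 < T) {p : ℝ} (hp : 0 < p) {r : ℝ≥0∞} (hr : r ≠ 0)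
    (hr' : r ≠ ∞) (f : TimeInterval T → ℝ) (n : ℕ) (t : TimeInterval T) :
    edist (f (dyadicFloor hT n t)) (f (dyadicFloor hT (n + 1) t)) ≤
      dyadicEnergy hT p r f ^ (1 / p) * r * r ^ n := by
  rw [dyadicFloor, dyadicFloor, ← dyadicPoint_succ_two_mul]
  rcases dyadicIndex_succ hT n t with h | h
  · simp [h]
  · have hlt : 2 * dyadicIndex n t < 2 ^ (n + 1) := by
      have := dyadicIndex_le hT (n + 1) t
      omega
    rw [h, mul_assoc, ← pow_succ']
    exact edist_dyadicPoint_le hT hp hr hr' f hlt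

theorem edist_dyadicFloor_near (hT : 0 < T) {p : ℝ} (hp : 0 < p) {r : ℝ≥0∞} (hr : r ≠ 0)
    (hr' : r ≠ ∞) (f : TimeInterval T → ℝ) {n : ℕ} {s t : TimeInterval T} (hst : s ≤ t)
    (h : (t : ℝ) - s ≤ T / 2 ^ n) :
    edist (f (dyadicFloor hT n s)) (f (dyadicFloor hT n t)) ≤
      dyadicEnergy hT p r f ^ (1 / p) * r ^ n := by
  rw [dyadicFloor, dyadicFloor]
  rcases dyadicIndex_near hT hst h with h | h
  · simp [h]
  · have hlt : dyadicIndex n s < 2 ^ n := by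
      have := dyadicIndex_le hT n t
      omega
    rw [h]
    exact edist_dyadicPoint_le hT hp hr hr' f hlt

theorem tendsto_dyadicLimit (hT : 0 < T) {p : ℝ} (hp : 0 < p) {r : ℝ≥0∞} (hr : r ≠ 0)
    (hr' : r < 1) {f : TimeInterval T → ℝ} (hf : dyadicEnergy hT p r f < ∞) (t : TimeInterval T) :
    Tendsto (fun n => f (dyadicFloor hT n t)) atTop (𝓝 (dyadicLimit hT f t)) := by
  have hC : dyadicEnergy hT p r f ^ (1 / p) * r ≠ ∞ :=
    ENNReal.mul_ne_top (ENNReal.rpow_ne_top_of_nonneg (by positivity) hf.ne) (hr'.trans_le le_top).ne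
  exact (cauchySeq_of_edist_le_geometric r _ hr' hC
    (edist_dyadicFloor_succ_le hT hp hr (hr'.trans_le le_top).ne f · t)).tendsto_limUnder

theorem edist_dyadicFloor_dyadicLimit_le (hT : 0 < T) {p : ℝ} (hp : 0 < p) {r : ℝ≥0∞} (hr : r ≠ 0)
    (hr' : r < 1) {f : TimeInterval T → ℝ} (hf : dyadicEnergy hT p r f < ∞) (n : ℕ)
    (t : TimeInterval T) :
    edist (f (dyadicFloor hT n t)) (dyadicLimit hT f t) ≤
      dyadicEnergy hT p r f ^ (1 / p) * r * r ^ n / (1 - r) :=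
  edist_le_of_edist_le_geometric_of_tendsto r _
    (edist_dyadicFloor_succ_le hT hp hr (hr'.trans_le le_top).ne f · t)
    (tendsto_dyadicLimit hT hp hr hr' hf t) n

/-- The chain goes from `s` down to its floor, across to the floor of `t`, and up to `t`; the two
outer legs are geometric tails. -/
theorem edist_dyadicLimit_le (hT : 0 < T) {p : ℝ} (hp : 0 < p) {r : ℝ≥0∞} (hr : r ≠ 0)
    (hr' : r < 1) {f : TimeInterval T → ℝ} (hf : dyadicEnergy hT p r f < ∞) {n : ℕ}
    {s t : TimeInterval T} (hst : s ≤ t) (h : (t : ℝ) - s ≤ T / 2 ^ n) :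
    edist (dyadicLimit hT f s) (dyadicLimit hT f t) ≤
      (1 + 2 * (r / (1 - r))) * dyadicEnergy hT p r f ^ (1 / p) * r ^ n := by
  have h1 := edist_dyadicFloor_dyadicLimit_le hT hp hr hr' hf n s
  have h2 := edist_dyadicFloor_dyadicLimit_le hT hp hr hr' hf n t
  have h3 := edist_dyadicFloor_near hT hp hr (hr'.trans_le le_top).ne f hst h
  rw [edist_comm] at h1
  refine (edist_triangle4 _ _ _ _).trans ((add_le_add_three h1 h3 h2).trans (le_of_eq ?_))
  simp only [div_eq_mul_inv]
  ring

/-- The Hölder weight `2 ^ (-θ)`. -/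
noncomputable def holderRatio (θ : ℝ) : ℝ≥0∞ := ENNReal.ofReal ((1 / 2 : ℝ) ^ θ)

theorem holderRatio_ne_zero (θ : ℝ) : holderRatio θ ≠ 0 :=
  (ENNReal.ofReal_pos.2 (by positivity)).ne'

theorem holderRatio_lt_one {θ : ℝ} (hθ : 0 < θ) : holderRatio θ < 1 :=
  ENNReal.ofReal_lt_one.2 (Real.rpow_lt_one (by norm_num) (by norm_num) hθ)

theorem holderRatio_pow (θ : ℝ) (n : ℕ) :
    holderRatio θ ^ n = ENNReal.ofReal (((1 / 2 : ℝ) ^ n) ^ θ) := by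
  rw [holderRatio, ← ENNReal.ofReal_pow (by positivity), Real.rpow_pow_comm (by norm_num)]

/-- The constant in the Hölder estimate for dyadic limits. -/
noncomputable def chainingConst (T θ : ℝ) : ℝ≥0∞ :=
  (1 + 2 * (holderRatio θ / (1 - holderRatio θ))) * ENNReal.ofReal ((2 / T) ^ θ)

theorem chainingConst_ne_top (T : ℝ) {θ : ℝ} (hθ : 0 < θ) : chainingConst T θ ≠ ∞ := by
  have h := holderRatio_lt_one hθ
  refine ENNReal.mul_ne_top (ENNReal.add_ne_top.2 ⟨ENNReal.one_ne_top,
    ENNReal.mul_ne_top ENNReal.ofNat_ne_top (ENNReal.div_ne_top ENNReal.ofReal_ne_top ?_)⟩)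
    ENNReal.ofReal_ne_top
  exact (tsub_pos_of_lt h).ne'

theorem holderSeminorm_dyadicLimit_le (hT : 0 < T) {p : ℝ} (hp : 0 < p) {θ : ℝ} (hθ : 0 < θ)
    {f : TimeInterval T → ℝ} (hf : dyadicEnergy hT p (holderRatio θ) f < ∞) :
    holderSeminorm edist θ (dyadicLimit hT f) ≤
      chainingConst T θ * dyadicEnergy hT p (holderRatio θ) f ^ (1 / p) := by
  refine holderSeminorm_le fun u v huv => ?_
  have huv' : 0 < (v : ℝ) - u := sub_pos.2 huv
  have hle : ((v : ℝ) - u) / T ≤ 1 := by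
    rw [div_le_one hT]
    linarith [u.2.1, v.2.2]
  -- The level is that of the gap: `2^{-(n+1)} < (v - u) / T ≤ 2^{-n}`. The upper bound makes the
  -- floors neighbours, the lower one produces the factor `(2 / T) ^ θ`.
  obtain ⟨n, hn, hn'⟩ := exists_nat_pow_near_of_lt_one (x := ((v : ℝ) - u) / T)
    (y := (1 / 2 : ℝ)) (by positivity) hle (by norm_num) (by norm_num)
  have hclose : (v : ℝ) - u ≤ T / 2 ^ n := by
    rw [div_le_iff₀ hT] at hn'
    rw [div_eq_inv_mul, ← inv_pow, ← one_div]
    exact hn'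
  refine (edist_dyadicLimit_le hT hp (holderRatio_ne_zero θ) (holderRatio_lt_one hθ) hf huv.le
    hclose).trans ?_
  have hpow : holderRatio θ ^ n ≤
      ENNReal.ofReal ((2 / T) ^ θ) * ENNReal.ofReal (|(v : ℝ) - u| ^ θ) := by
    rw [holderRatio_pow, ← ENNReal.ofReal_mul (by positivity),
      ← Real.mul_rpow (by positivity) (abs_nonneg _), abs_of_pos huv']
    refine ENNReal.ofReal_le_ofReal (Real.rpow_le_rpow (by positivity) ?_ hθ.le)
    rw [pow_succ] at hn
    have : 2 / T * ((v : ℝ) - u) = 2 * (((v : ℝ) - u) / T) := by ring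
    rw [this]
    linarith
  calc _ ≤ (1 + 2 * (holderRatio θ / (1 - holderRatio θ))) *
        dyadicEnergy hT p (holderRatio θ) f ^ (1 / p) *
        (ENNReal.ofReal ((2 / T) ^ θ) * ENNReal.ofReal (|(v : ℝ) - u| ^ θ)) := by gcongr
    _ = _ := by rw [chainingConst]; ring

/-- The constant bounding the expected dyadic energy. -/
noncomputable def energyConst (T p κ θ : ℝ) : ℝ≥0∞ :=
  ∑' n : ℕ, 2 ^ n * (ENNReal.ofReal ((T / 2 ^ n) ^ κ) / holderRatio θ ^ n) ^ p

/-- The series is geometric with ratio `2 ^ (1 - κ p + θ p)`: the `2 ^ n` increments per level cost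
the `1`, whence the loss of `1 / p` in the exponent. -/
theorem energyConst_ne_top (hT : 0 < T) {p κ θ : ℝ} (hp : 0 < p) (h : θ + 1 / p < κ) :
    energyConst T p κ θ ≠ ∞ := by
  have hterm : ∀ n : ℕ, (2 : ℝ≥0∞) ^ n * (ENNReal.ofReal ((T / 2 ^ n) ^ κ) / holderRatio θ ^ n) ^ p
      = ENNReal.ofReal (T ^ (κ * p) * ((2 : ℝ) ^ (1 - κ * p + θ * p)) ^ n) := by
    intro n
    have hx : (0 : ℝ) < 2 ^ n := by positivity
    rw [holderRatio_pow, ← ENNReal.ofReal_div_of_pos (by positivity),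
      ENNReal.ofReal_rpow_of_nonneg (by positivity) hp.le, ← ENNReal.ofReal_ofNat,
      ← ENNReal.ofReal_pow (by norm_num), ← ENNReal.ofReal_mul (by positivity),
      Real.rpow_pow_comm (by norm_num), one_div, inv_pow, Real.inv_rpow hx.le, div_inv_eq_mul,
      Real.mul_rpow (by positivity) (by positivity), ← Real.rpow_mul (by positivity),
      ← Real.rpow_mul (by positivity), Real.div_rpow hT.le hx.le, Real.rpow_add hx,
      Real.rpow_sub hx, Real.rpow_one]
    congr 1
    ring
  have hq : (2 : ℝ) ^ (1 - κ * p + θ * p) < 1 := by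
    refine Real.rpow_lt_one_of_one_lt_of_neg (by norm_num) ?_
    have : (θ + 1 / p) * p < κ * p := mul_lt_mul_of_pos_right h hp
    have e : (θ + 1 / p) * p = θ * p + 1 := by field_simp
    linarith
  have hsum : Summable fun n : ℕ => T ^ (κ * p) * ((2 : ℝ) ^ (1 - κ * p + θ * p)) ^ n :=
    (summable_geometric_of_lt_one (by positivity) hq).mul_left _
  rw [energyConst, tsum_congr hterm, ← ENNReal.ofReal_tsum_of_nonneg (fun n => by positivity) hsum]
  exact ENNReal.ofReal_ne_top

end Dyadic

/-! ### Measurability on the path space -/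

/-- A closed set in a separable space is the closure of a countable subset, so membership is a
countable condition on distances. -/
theorem measurable_of_measurable_dist {Ω E : Type*} [MeasurableSpace Ω] [PseudoMetricSpace E]
    [SecondCountableTopology E] [MeasurableSpace E] [BorelSpace E] {f : Ω → E}
    (h : ∀ e, Measurable fun ω => dist (f ω) e) : Measurable f := by
  refine measurable_of_isClosed fun s hs => ?_
  obtain ⟨D, hDs, hDc, hD⟩ := (TopologicalSpace.IsSeparable.of_separableSpace
    s).exists_countable_dense_subset
  have hcl : s = closure D := hD.antisymm (closure_minimal hDs hs)
  have : f ⁻¹' s = ⋂ n : ℕ, ⋃ e ∈ D, {ω | dist (f ω) e < 1 / ((n : ℝ) + 1)} := by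
    ext ω
    rw [mem_preimage, hcl, Metric.mem_closure_iff]
    simp only [mem_iInter, mem_iUnion, mem_ofPred_eq, exists_prop]
    constructor
    · intro H n
      exact H _ Nat.one_div_pos_of_nat
    · intro H ε hε
      obtain ⟨n, hn⟩ := exists_nat_one_div_lt hε
      obtain ⟨e, he, hlt⟩ := H n
      exact ⟨e, he, hlt.trans hn⟩
  rw [this]
  exact MeasurableSet.iInter fun n => MeasurableSet.biUnion hDc fun e _ =>
    measurableSet_lt (h e) measurable_const

/-- By continuity the supremum distance is determined on a countable dense set of times, so
evaluations control the Borel σ-algebra of the path space. -/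
theorem measurable_pathSpace_of_eval {Ω : Type*} [MeasurableSpace Ω] {T : ℝ}
    {f : Ω → PathSpace T} (h : ∀ t, Measurable fun ω => f ω t) : Measurable f := by
  refine measurable_of_measurable_dist fun g => measurable_of_Iic fun c => ?_
  obtain ⟨D, hDc, hD⟩ := TopologicalSpace.exists_countable_dense (TimeInterval T)
  rcases lt_or_ge c 0 with hc | hc
  · convert MeasurableSet.empty
    ext ω
    simp [hc.trans_le dist_nonneg]
  · have : (fun ω => dist (f ω) g) ⁻¹' Iic c = ⋂ t ∈ D, {ω | dist (f ω t) (g t) ≤ c} := by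
      ext ω
      simp only [mem_preimage, mem_Iic, mem_iInter, mem_ofPred_eq, ContinuousMap.dist_le hc]
      refine ⟨fun H t _ => H t, fun H t => ?_⟩
      have hcl : IsClosed {t | dist (f ω t) (g t) ≤ c} :=
        isClosed_le (by fun_prop) continuous_const
      exact (closure_minimal H hcl) (hD t)
    rw [this]
    exact MeasurableSet.biInter hDc fun t _ =>
      measurableSet_le ((h t).dist measurable_const) measurable_const

theorem measurable_pathSpace_uncurry (T : ℝ) :
    Measurable fun z : PathSpace T × TimeInterval T => z.1 z.2 :=
  ContinuousEval.continuous_eval.measurable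

theorem measurable_pathSpace_eval {T : ℝ} (t : TimeInterval T) :
    Measurable fun x : PathSpace T => x t :=
  (ContinuousEvalConst.continuous_eval_const t).measurable

/-- A supremum, even uncountable, of continuous functions is lower semicontinuous. -/
theorem measurable_holderSeminorm {T : ℝ} (θ : ℝ) :
    Measurable fun x : PathSpace T => holderSeminorm edist θ x := by
  refine LowerSemicontinuous.measurable ?_
  refine lowerSemicontinuous_iSup fun u => lowerSemicontinuous_iSup fun v =>
    lowerSemicontinuous_iSup fun huv => Continuous.lowerSemicontinuous ?_
  have h0 : 0 < |(v : ℝ) - u| := abs_pos.2 (sub_ne_zero.2 (Subtype.coe_lt_coe.2 huv).ne')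
  exact (ENNReal.continuous_div_const _
    (ENNReal.ofReal_pos.2 (Real.rpow_pos_of_pos h0 _)).ne').comp
    (Continuous.edist (by fun_prop) (by fun_prop))

instance (T : ℝ) : IsFiniteMeasure (timeMeasure T) := by
  refine ⟨?_⟩
  rw [timeMeasure, (MeasurableEmbedding.subtype_coe measurableSet_Icc).comap_apply]
  refine (measure_mono (t := Icc 0 T) ?_).trans_lt (by simp)
  rintro _ ⟨x, -, rfl⟩
  exact x.2

theorem measurable_sobolev_integrand {T : ℝ} (α p : ℝ) :
    Measurable fun w : PathSpace T × (TimeInterval T × TimeInterval T) =>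
      edist (w.1 w.2.1) (w.1 w.2.2) ^ p /
        ENNReal.ofReal (|(w.2.2 : ℝ) - (w.2.1 : ℝ)| ^ (1 + α * p)) := by
  have h1 : Measurable fun w : PathSpace T × (TimeInterval T × TimeInterval T) => w.1 w.2.1 :=
    (measurable_pathSpace_uncurry T).comp (measurable_fst.prodMk (measurable_fst.comp measurable_snd))
  have h2 : Measurable fun w : PathSpace T × (TimeInterval T × TimeInterval T) => w.1 w.2.2 :=
    (measurable_pathSpace_uncurry T).comp (measurable_fst.prodMk (measurable_snd.comp measurable_snd))
  exact ((h1.edist h2).pow_const p).div (by fun_prop)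

theorem measurable_sobolevSeminorm {T : ℝ} (α p : ℝ) :
    Measurable fun x : PathSpace T => sobolevSeminorm edist α p x :=
  (measurable_sobolev_integrand α p).lintegral_prod_right'.pow_const _

/-! ### Continuous modifications -/

section Modification

variable {Ω : Type*} [MeasurableSpace Ω] {T p κ : ℝ}

theorem measurable_dyadicEnergy (hT : 0 < T) (p : ℝ) (r : ℝ≥0∞) {X : TimeInterval T → Ω → ℝ}
    (hX : ∀ t, Measurable (X t)) :
    Measurable fun ω => dyadicEnergy hT p r fun t => X t ω :=
  Measurable.tsum fun _ => Finset.measurable_sum _ fun _ _ =>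
    (((hX _).edist (hX _)).div_const _).pow_const _

theorem lintegral_dyadicEnergy_le (hT : 0 < T) (hp : 0 < p) {Q : Measure Ω} {M : ℝ≥0∞}
    {X : TimeInterval T → Ω → ℝ} (hX : ∀ t, Measurable (X t))
    (hM : ∀ s t, ∫⁻ ω, edist (X s ω) (X t ω) ^ p ∂Q ≤
      (M * ENNReal.ofReal (|(t : ℝ) - s| ^ κ)) ^ p) (θ : ℝ) :
    ∫⁻ ω, dyadicEnergy hT p (holderRatio θ) (fun t => X t ω) ∂Q ≤
      energyConst T p κ θ * M ^ p := by
  have hm : ∀ n k, Measurable fun ω => (edist (X (dyadicPoint hT n k) ω)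
      (X (dyadicPoint hT n (k + 1)) ω) / holderRatio θ ^ n) ^ p := fun n k =>
    (((hX _).edist (hX _)).div_const _).pow_const _
  simp only [dyadicEnergy]
  rw [lintegral_tsum fun n => (Finset.measurable_sum _ fun k _ => hm n k).aemeasurable,
    energyConst, ← ENNReal.tsum_mul_right]
  refine ENNReal.tsum_le_tsum fun n => ?_
  rw [lintegral_finsetSum _ fun k _ => hm n k]
  refine (Finset.sum_le_card_nsmul _ _ ((ENNReal.ofReal ((T / 2 ^ n) ^ κ) / holderRatio θ ^ n) ^ p *
    M ^ p) fun k hk => ?_).trans (le_of_eq ?_)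
  · have hk' := Finset.mem_range.1 hk
    have hd : |(dyadicPoint hT n (k + 1) : ℝ) - dyadicPoint hT n k| = T / 2 ^ n := by
      rw [coe_dyadicPoint hT hk'.le, coe_dyadicPoint hT hk', ← sub_div]
      push_cast
      rw [abs_of_nonneg] <;> ring_nf
      positivity
    have h := hM (dyadicPoint hT n k) (dyadicPoint hT n (k + 1))
    rw [hd] at h
    have hr0 : holderRatio θ ^ n ≠ 0 := pow_ne_zero _ (holderRatio_ne_zero θ)
    simp_rw [ENNReal.div_rpow_of_nonneg _ _ hp.le, div_eq_mul_inv]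
    rw [lintegral_mul_const' _ _ (ENNReal.inv_ne_top.2 (by simp [hr0, hp.le]))]
    refine (mul_le_mul_left h _).trans (le_of_eq ?_)
    rw [ENNReal.mul_rpow_of_nonneg _ _ hp.le, mul_assoc, mul_comm, div_eq_mul_inv T]
  · rw [Finset.card_range, nsmul_eq_mul, mul_assoc]
    push_cast
    rfl

theorem exists_continuous_modification (hT : 0 < T) (hp : 0 < p) (hκ : 1 / p < κ)
    {Q : Measure Ω} {M : ℝ≥0∞} (hMtop : M ≠ ∞) {X : TimeInterval T → Ω → ℝ}
    (hX : ∀ t, Measurable (X t))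
    (hM : ∀ s t, ∫⁻ ω, edist (X s ω) (X t ω) ^ p ∂Q ≤
      (M * ENNReal.ofReal (|(t : ℝ) - s| ^ κ)) ^ p) :
    ∃ Y : Ω → PathSpace T, Measurable Y ∧ (∀ t, ∀ᵐ ω ∂Q, Y ω t = X t ω) ∧
      ∀ θ : ℝ, 0 < θ → θ + 1 / p < κ →
        ∫⁻ ω, holderSeminorm edist θ (Y ω) ^ p ∂Q ≤
          chainingConst T θ ^ p * energyConst T p κ θ * M ^ p := by
  have hfin : ∀ θ : ℝ, θ + 1 / p < κ →
      ∀ᵐ ω ∂Q, dyadicEnergy hT p (holderRatio θ) (fun t => X t ω) < ∞ := fun θ hθ =>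
    ae_lt_top (measurable_dyadicEnergy hT p _ hX) ((lintegral_dyadicEnergy_le hT hp hX hM θ).trans_lt
      (ENNReal.mul_lt_top (energyConst_ne_top hT hp hθ).lt_top
        (ENNReal.rpow_lt_top_of_nonneg hp.le hMtop))).ne
  -- One exponent fixes the good set on which `Y` is the dyadic limit. The limit itself does not
  -- involve the exponent, so the same `Y` serves every admissible `θ`.
  obtain ⟨θ₀, hθ₀, hθ₀'⟩ : ∃ θ₀ : ℝ, 0 < θ₀ ∧ θ₀ + 1 / p < κ :=
    ⟨(κ - 1 / p) / 2, by linarith, by linarith⟩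
  set G : Set Ω := {ω | dyadicEnergy hT p (holderRatio θ₀) (fun t => X t ω) < ∞} with hG
  have hGm : MeasurableSet G :=
    measurableSet_lt (measurable_dyadicEnergy hT p _ hX) measurable_const
  have hcont : ∀ ω ∈ G, Continuous (dyadicLimit hT fun t => X t ω) := fun ω hω =>
    continuous_of_holderSeminorm_lt_top hθ₀ <|
      (holderSeminorm_dyadicLimit_le hT hp hθ₀ hω).trans_lt
        (ENNReal.mul_lt_top (chainingConst_ne_top T hθ₀).lt_top
          (ENNReal.rpow_lt_top_of_nonneg (by positivity) hω.ne))
  classical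
  let Y : Ω → PathSpace T := fun ω =>
    if h : ω ∈ G then ⟨dyadicLimit hT fun t => X t ω, hcont ω h⟩ else 0
  have hYG : ∀ ω ∈ G, ∀ t, Y ω t = dyadicLimit hT (fun t => X t ω) t := fun ω h t => by
    simp [Y, h]
  have hYG' : ∀ ω ∉ G, ∀ t, Y ω t = 0 := fun ω h t => by simp [Y, h]
  have hYm : Measurable Y := by
    refine measurable_pathSpace_of_eval fun t => ?_
    refine measurable_of_tendsto_metrizable (f := fun n => G.indicator (X (dyadicFloor hT n t)))
      (fun n => (hX _).indicator hGm) (tendsto_pi_nhds.2 fun ω => ?_)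
    by_cases h : ω ∈ G
    · simp only [indicator_of_mem h, hYG ω h]
      exact tendsto_dyadicLimit hT hp (holderRatio_ne_zero _) (holderRatio_lt_one hθ₀) h t
    · simp only [indicator_of_notMem h, hYG' ω h]
      exact tendsto_const_nhds
  refine ⟨Y, hYm, fun t => ?_, fun θ hθ hθ' => ?_⟩
  · have hYt : Measurable fun ω => Y ω t := (measurable_pathSpace_eval t).comp hYm
    have hκ0 : 0 < κ := lt_trans (by positivity) hκ
    -- The paths of `X` need not be continuous, so `Y_t` is identified with `X_t` in mean: by Fatou,
    -- their distance is bounded by the limit of the moments at the dyadic floors of `t`, which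
    -- vanishes.
    have hzero : ∫⁻ ω, edist (Y ω t) (X t ω) ^ p ∂Q = 0 := by
      refine le_antisymm ?_ zero_le
      have hlim : ∫⁻ ω, edist (Y ω t) (X t ω) ^ p ∂Q ≤
          ∫⁻ ω, liminf (fun n => edist (X (dyadicFloor hT n t) ω) (X t ω) ^ p) atTop ∂Q := by
        refine lintegral_mono_ae ?_
        filter_upwards [hfin θ₀ hθ₀'] with ω hω
        rw [hYG ω hω]
        have h1 := tendsto_dyadicLimit hT hp (holderRatio_ne_zero _) (holderRatio_lt_one hθ₀) hω t
        have h2 := ((ENNReal.continuous_rpow_const (y := p)).tendsto _).comp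
          (h1.edist (tendsto_const_nhds (x := X t ω)))
        exact h2.liminf_eq.ge
      have hbound : Tendsto (fun n => (M * ENNReal.ofReal (|(t : ℝ) - dyadicFloor hT n t| ^ κ)) ^ p)
          atTop (𝓝 0) := by
        have h1 : Tendsto (fun n : ℕ => T / 2 ^ n) atTop (𝓝 0) := by
          simpa [div_eq_mul_inv] using
            (tendsto_pow_atTop_nhds_zero_of_lt_one (r := (2 : ℝ)⁻¹) (by norm_num)
              (by norm_num)).const_mul T
        have h2 : Tendsto (fun n => |(t : ℝ) - dyadicFloor hT n t|) atTop (𝓝 0) :=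
          squeeze_zero (fun _ => abs_nonneg _) (fun n => abs_dyadicFloor_sub_le hT n t) h1
        have h3 : Tendsto (fun n => |(t : ℝ) - dyadicFloor hT n t| ^ κ) atTop (𝓝 0) := by
          have := h2.rpow_const (p := κ) (Or.inr hκ0.le)
          rwa [Real.zero_rpow hκ0.ne'] at this
        have h4 := ENNReal.Tendsto.const_mul (a := M) (ENNReal.tendsto_ofReal h3) (Or.inr hMtop)
        have h5 := ((ENNReal.continuous_rpow_const (y := p)).tendsto _).comp h4
        simpa [Function.comp_def, hp] using h5
      calc _ ≤ _ := hlim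
        _ ≤ liminf (fun n => ∫⁻ ω, edist (X (dyadicFloor hT n t) ω) (X t ω) ^ p ∂Q) atTop :=
          lintegral_liminf_le fun n => ((hX _).edist (hX _)).pow_const _
        _ ≤ liminf (fun n => (M * ENNReal.ofReal (|(t : ℝ) - dyadicFloor hT n t| ^ κ)) ^ p) atTop :=
          liminf_le_liminf (Eventually.of_forall fun n => hM _ _)
        _ = 0 := hbound.liminf_eq
    rw [lintegral_eq_zero_iff ((hYt.edist (hX t)).pow_const _)] at hzero
    filter_upwards [hzero] with ω hω
    simpa [ENNReal.rpow_eq_zero_iff, hp, hp.not_gt] using hω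
  · have hae : ∀ᵐ ω ∂Q, holderSeminorm edist θ (Y ω) ^ p ≤
        chainingConst T θ ^ p * dyadicEnergy hT p (holderRatio θ) (fun t => X t ω) := by
      filter_upwards [hfin θ hθ', hfin θ₀ hθ₀'] with ω hω hω₀
      have hYeq : ⇑(Y ω) = dyadicLimit hT fun t => X t ω := funext (hYG ω hω₀)
      rw [hYeq]
      refine (ENNReal.rpow_le_rpow (holderSeminorm_dyadicLimit_le hT hp hθ hω) hp.le).trans ?_
      rw [ENNReal.mul_rpow_of_nonneg _ _ hp.le, one_div, ENNReal.rpow_inv_rpow hp.ne']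
    refine (lintegral_mono_ae hae).trans ?_
    rw [lintegral_const_mul _ (measurable_dyadicEnergy hT p _ hX), mul_assoc]
    exact mul_le_mul_right (lintegral_dyadicEnergy_le hT hp hX hM θ) _

end Modification

/-! ### Seminorms of curves dominated by an averaged distance of paths -/

section Averaged

variable {Z E : Type*} [MeasurableSpace Z] {T p : ℝ} {Q : Measure Z} {Y : Z → PathSpace T}
  {d : E → E → ℝ≥0∞} {x : TimeInterval T → E}

theorem lintegral_edist_rpow_le (hp : 0 < p) (θ : ℝ) (u v : TimeInterval T) :
    (∫⁻ z, edist (Y z u) (Y z v) ^ p ∂Q) ^ (1 / p) ≤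
      (∫⁻ z, holderSeminorm edist θ (Y z) ^ p ∂Q) ^ (1 / p) *
        ENNReal.ofReal (|(v : ℝ) - u| ^ θ) := by
  have h : ∫⁻ z, edist (Y z u) (Y z v) ^ p ∂Q ≤
      (∫⁻ z, holderSeminorm edist θ (Y z) ^ p ∂Q) * ENNReal.ofReal (|(v : ℝ) - u| ^ θ) ^ p := by
    rw [← lintegral_mul_const' _ _ (ENNReal.rpow_ne_top_of_nonneg hp.le ENNReal.ofReal_ne_top)]
    refine lintegral_mono fun z => ?_
    rw [← ENNReal.mul_rpow_of_nonneg _ _ hp.le]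
    exact ENNReal.rpow_le_rpow (edist_le_holderSeminorm_mul θ _ u v) hp.le
  refine (ENNReal.rpow_le_rpow h (by positivity)).trans (le_of_eq ?_)
  rw [ENNReal.mul_rpow_of_nonneg _ _ (by positivity), one_div, ENNReal.rpow_rpow_inv hp.ne']

theorem le_mul_of_le_lintegral (hp : 0 < p)
    (h : ∀ u v, d (x u) (x v) ≤ (∫⁻ z, edist (Y z u) (Y z v) ^ p ∂Q) ^ (1 / p)) (θ : ℝ)
    (u v : TimeInterval T) :
    d (x u) (x v) ≤ (∫⁻ z, holderSeminorm edist θ (Y z) ^ p ∂Q) ^ (1 / p) *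
        ENNReal.ofReal (|(v : ℝ) - u| ^ θ) :=
  (h u v).trans (lintegral_edist_rpow_le hp θ u v)

theorem holderSeminorm_rpow_le_lintegral (hp : 0 < p)
    (h : ∀ u v, d (x u) (x v) ≤ (∫⁻ z, edist (Y z u) (Y z v) ^ p ∂Q) ^ (1 / p)) (θ : ℝ) :
    holderSeminorm d θ x ^ p ≤ ∫⁻ z, holderSeminorm edist θ (Y z) ^ p ∂Q := by
  rw [← ENNReal.le_rpow_inv_iff hp, ← one_div]
  exact holderSeminorm_le fun u v _ => le_mul_of_le_lintegral hp h θ u v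

theorem sobolevSeminorm_rpow (hp : 0 < p) (α : ℝ) :
    sobolevSeminorm d α p x ^ p = ∫⁻ z : TimeInterval T × TimeInterval T,
      d (x z.1) (x z.2) ^ p / ENNReal.ofReal (|(z.2 : ℝ) - (z.1 : ℝ)| ^ (1 + α * p))
        ∂((timeMeasure T).prod (timeMeasure T)) := by
  rw [sobolevSeminorm, one_div, ENNReal.rpow_inv_rpow hp.ne']

theorem lintegral_sobolevSeminorm_rpow [SFinite Q] (hp : 0 < p) (hY : Measurable Y) (α : ℝ) :
    ∫⁻ z, sobolevSeminorm edist α p (Y z) ^ p ∂Q =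
      ∫⁻ w : TimeInterval T × TimeInterval T, (∫⁻ z, edist (Y z w.1) (Y z w.2) ^ p ∂Q) /
        ENNReal.ofReal (|(w.2 : ℝ) - (w.1 : ℝ)| ^ (1 + α * p))
        ∂((timeMeasure T).prod (timeMeasure T)) := by
  simp_rw [sobolevSeminorm_rpow hp]
  rw [lintegral_lintegral_swap]
  · refine lintegral_congr fun w => ?_
    simp_rw [div_eq_mul_inv]
    refine lintegral_mul_const _ ?_
    exact (((measurable_pathSpace_eval w.1).comp hY).edist
      ((measurable_pathSpace_eval w.2).comp hY)).pow_const _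
  · exact ((measurable_sobolev_integrand α p).comp
      (hY.prodMap measurable_id)).aemeasurable

theorem sobolevSeminorm_rpow_eq_lintegral [SFinite Q] (hp : 0 < p) (hY : Measurable Y)
    (h : ∀ u v, d (x u) (x v) = (∫⁻ z, edist (Y z u) (Y z v) ^ p ∂Q) ^ (1 / p)) (α : ℝ) :
    sobolevSeminorm d α p x ^ p = ∫⁻ z, sobolevSeminorm edist α p (Y z) ^ p ∂Q := by
  rw [lintegral_sobolevSeminorm_rpow hp hY, sobolevSeminorm_rpow hp]
  simp_rw [h, one_div, ENNReal.rpow_inv_rpow hp.ne']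

theorem sobolevSeminorm_rpow_le_lintegral [SFinite Q] (hp : 0 < p) (hY : Measurable Y)
    (h : ∀ u v, d (x u) (x v) ≤ (∫⁻ z, edist (Y z u) (Y z v) ^ p ∂Q) ^ (1 / p)) (α : ℝ) :
    sobolevSeminorm d α p x ^ p ≤ ∫⁻ z, sobolevSeminorm edist α p (Y z) ^ p ∂Q := by
  rw [lintegral_sobolevSeminorm_rpow hp hY, sobolevSeminorm_rpow hp]
  refine lintegral_mono fun w => ENNReal.div_le_div_right ?_ _
  rw [← ENNReal.le_rpow_inv_iff hp, ← one_div]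
  exact h _ _

end Averaged

/-! ### Hölder curves are Sobolev curves -/

theorem lintegral_abs_rpow_lt_top {ε : ℝ} (hε : -1 < ε) {T : ℝ} (hT : 0 ≤ T) :
    ∫⁻ w in Icc (-T) T, ENNReal.ofReal (|w| ^ ε) < ∞ := by
  have h1 : IntervalIntegrable (fun w : ℝ => |w| ^ ε) volume 0 T := by
    refine (intervalIntegral.intervalIntegrable_rpow' hε).congr fun w hw => ?_
    rw [uIoc_of_le hT] at hw
    simp [abs_of_pos hw.1]
  have h2 : IntervalIntegrable (fun w : ℝ => |w| ^ ε) volume (-T) 0 := by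
    have := (IntervalIntegrable.iff_comp_neg).1 h1
    simpa using this.symm
  have h3 := (h2.trans h1).1
  rw [← integrableOn_Icc_iff_integrableOn_Ioc] at h3
  exact h3.lintegral_lt_top

theorem lintegral_timeMeasure {T : ℝ} (f : ℝ → ℝ≥0∞) :
    ∫⁻ v : TimeInterval T, f v ∂(timeMeasure T) = ∫⁻ v in Icc 0 T, f v :=
  lintegral_subtype_comap measurableSet_Icc f

/-- The Hölder bound reduces the integrand to `|v - u| ^ ((κ - α) p - 1)`, integrable across the
diagonal because `α < κ`. -/
theorem sobolevSeminorm_lt_top_of_le {E : Type*} {T p κ α : ℝ} (hT : 0 ≤ T) (hp : 0 < p)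
    (hα : α < κ) {d : E → E → ℝ≥0∞} {x : TimeInterval T → E} {C : ℝ≥0∞} (hC : C ≠ ∞)
    (h : ∀ u v, d (x u) (x v) ≤ C * ENNReal.ofReal (|(v : ℝ) - u| ^ κ))
    (h0 : ∀ u, d (x u) (x u) = 0) : sobolevSeminorm d α p x ^ p < ∞ := by
  set ε : ℝ := (κ - α) * p - 1 with hε
  have hε' : -1 < ε := by
    have : 0 < (κ - α) * p := mul_pos (sub_pos.2 hα) hp
    linarith
  rw [sobolevSeminorm_rpow hp]
  have hle : ∀ w : TimeInterval T × TimeInterval T,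
      d (x w.1) (x w.2) ^ p / ENNReal.ofReal (|(w.2 : ℝ) - (w.1 : ℝ)| ^ (1 + α * p)) ≤
        C ^ p * ENNReal.ofReal (|(w.2 : ℝ) - w.1| ^ ε) := by
    rintro ⟨u, v⟩
    rcases eq_or_ne u v with rfl | huv
    · simp [h0, hp]
    · have hpos : 0 < |(v : ℝ) - u| :=
        abs_pos.2 (sub_ne_zero.2 fun h => huv (Subtype.ext h.symm))
      refine ENNReal.div_le_of_le_mul ?_
      refine (ENNReal.rpow_le_rpow (h u v) hp.le).trans (le_of_eq ?_)
      rw [ENNReal.mul_rpow_of_nonneg _ _ hp.le, mul_assoc, ← ENNReal.ofReal_mul (by positivity),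
        ← Real.rpow_add hpos, ENNReal.ofReal_rpow_of_nonneg (by positivity) hp.le,
        ← Real.rpow_mul hpos.le, hε]
      ring_nf
  have hm : Measurable fun w : TimeInterval T × TimeInterval T =>
      ENNReal.ofReal (|(w.2 : ℝ) - w.1| ^ ε) := by fun_prop
  refine (lintegral_mono hle).trans_lt ?_
  rw [lintegral_const_mul _ hm]
  refine ENNReal.mul_lt_top (ENNReal.rpow_lt_top_of_nonneg hp.le hC) ?_
  rw [lintegral_prod _ hm.aemeasurable]
  have hinner : ∀ u : TimeInterval T,
      ∫⁻ v : TimeInterval T, ENNReal.ofReal (|(v : ℝ) - u| ^ ε) ∂(timeMeasure T) ≤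
        ∫⁻ w in Icc (-T) T, ENNReal.ofReal (|w| ^ ε) := by
    intro u
    -- Translation by `u` carries `[0,T]` into `[-T,T]`, a window independent of `u`.
    rw [lintegral_timeMeasure fun v : ℝ => ENNReal.ofReal (|v - u| ^ ε),
      ← lintegral_indicator measurableSet_Icc, ← lintegral_indicator measurableSet_Icc,
      ← lintegral_sub_right_eq_self ((Icc (-T) T).indicator _) (u : ℝ)]
    refine lintegral_mono fun v => ?_
    by_cases hv : v ∈ Icc 0 T
    · have : v - (u : ℝ) ∈ Icc (-T) T := ⟨by linarith [hv.1, u.2.2], by linarith [hv.2, u.2.1]⟩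
      rw [indicator_of_mem hv, indicator_of_mem this]
    · rw [indicator_of_notMem hv]
      exact zero_le
  refine (lintegral_mono hinner).trans_lt ?_
  rw [lintegral_const]
  exact ENNReal.mul_lt_top (lintegral_abs_rpow_lt_top hε' hT) (measure_lt_top _ _)

/-! ### The marginals of a measure on the path space -/

section Marginals

variable {T p : ℝ} {ρ : Measure (PathSpace T)} [IsProbabilityMeasure ρ]

theorem isCoupling_map_eval (u v : TimeInterval T) :
    IsCoupling (ρ.map fun x : PathSpace T => (x u, x v)) (ρ.map fun x : PathSpace T => x u)
      (ρ.map fun x : PathSpace T => x v) := by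
  have h : Measurable fun x : PathSpace T => (x u, x v) :=
    (measurable_pathSpace_eval u).prodMk (measurable_pathSpace_eval v)
  exact ⟨Measure.isProbabilityMeasure_map h.aemeasurable, Measure.map_map measurable_fst h,
    Measure.map_map measurable_snd h⟩

/-- The two-time law is an admissible coupling, for any law of paths. The bound thus holds for all
pairs of times at once, whereas optimality of the random lift holds only off a null set depending on
the pair. -/
theorem wasserstein_map_eval_le (hp : 0 < p) (u v : TimeInterval T) :
    wasserstein p (ρ.map fun x : PathSpace T => x u) (ρ.map fun x : PathSpace T => x v) ≤
      (∫⁻ x, edist (x u) (x v) ^ p ∂ρ) ^ (1 / p) := by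
  refine ENNReal.rpow_le_rpow (iInf₂_le_of_le _ (isCoupling_map_eval u v) ?_) (by positivity)
  rw [transportCost, lintegral_map (by fun_prop)
    ((measurable_pathSpace_eval u).prodMk (measurable_pathSpace_eval v))]

theorem measurable_map_eval : Measurable fun t => ρ.map fun x : PathSpace T => x t := by
  refine Measure.measurable_of_measurable_coe _ fun s hs => ?_
  simp_rw [fun t => Measure.map_apply (μ := ρ) (measurable_pathSpace_eval t) hs]
  exact measurable_measure_prodMk_left
    (((measurable_pathSpace_uncurry T).comp measurable_swap) hs)

variable {θ x₀ : ℝ}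

/-- A finite moment at one time spreads to all times, since the increments are controlled by the
Hölder seminorm. -/
theorem memPp_map_eval (hp : 1 ≤ p) (hH : ∫⁻ x : PathSpace T, holderSeminorm edist θ x ^ p ∂ρ < ∞)
    {s : TimeInterval T} (h0 : ∫⁻ x : PathSpace T, edist (x s) x₀ ^ p ∂ρ < ∞)
    (t : TimeInterval T) : MemPp p (ρ.map fun x : PathSpace T => x t) := by
  have hp0 : 0 < p := by linarith
  have hm := measurable_pathSpace_eval t
  refine ⟨Measure.isProbabilityMeasure_map hm.aemeasurable, x₀, ?_⟩
  have hms : Measurable fun x : PathSpace T => edist (x t) (x s) ^ p :=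
    (hm.edist (measurable_pathSpace_eval s)).pow_const _
  have hfin : ∫⁻ x : PathSpace T, edist (x t) (x s) ^ p ∂ρ < ∞ := by
    have h := lintegral_edist_rpow_le (Q := ρ) (Y := id) hp0 θ t s
    have h' := h.trans_lt (ENNReal.mul_lt_top
      (ENNReal.rpow_lt_top_of_nonneg (by positivity) hH.ne) ENNReal.ofReal_lt_top)
    exact (ENNReal.rpow_lt_top_iff_of_pos (by positivity)).1 h'
  rw [lintegral_map (by fun_prop) hm]
  have hle : ∀ x : PathSpace T, edist (x t) x₀ ^ p ≤
      2 ^ (p - 1) * (edist (x t) (x s) ^ p + edist (x s) x₀ ^ p) := fun x =>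
    (ENNReal.rpow_le_rpow (edist_triangle _ (x s) _) hp0.le).trans
      (ENNReal.rpow_add_le_mul_rpow_add_rpow _ _ hp)
  refine (lintegral_mono hle).trans_lt ?_
  have h2 : (2 : ℝ≥0∞) ^ (p - 1) ≠ ∞ :=
    ENNReal.rpow_ne_top_of_nonneg (by linarith) ENNReal.ofNat_ne_top
  rw [lintegral_const_mul' _ _ h2, lintegral_add_left hms]
  exact ENNReal.mul_lt_top h2.lt_top (ENNReal.add_lt_top.2 ⟨hfin, h0⟩)

theorem memHolderPp_map_eval (hp : 1 ≤ p) (hθ : 0 < θ)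
    (hH : ∫⁻ x : PathSpace T, holderSeminorm edist θ x ^ p ∂ρ < ∞)
    {s : TimeInterval T} (h0 : ∫⁻ x : PathSpace T, edist (x s) x₀ ^ p ∂ρ < ∞) :
    MemHolderPp θ p fun t => ρ.map fun x : PathSpace T => x t := by
  have hp0 : 0 < p := by linarith
  have hW := wasserstein_map_eval_le (ρ := ρ) hp0
  have hC := ENNReal.rpow_ne_top_of_nonneg (y := 1 / p) (by positivity) hH.ne
  refine ⟨memPp_map_eval hp hH h0, tendsto_of_le_mul_abs_sub_rpow hθ hC
    (le_mul_of_le_lintegral (Y := id) hp0 hW θ), ?_⟩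
  exact (holderSeminorm_le fun u v _ => le_mul_of_le_lintegral (Y := id) hp0 hW θ u v).trans_lt
    hC.lt_top

theorem memSobolevPp_map_eval (hp : 1 ≤ p) {α : ℝ}
    (hS : ∫⁻ x : PathSpace T, sobolevSeminorm edist α p x ^ p ∂ρ < ∞)
    (hH : ∫⁻ x : PathSpace T, holderSeminorm edist θ x ^ p ∂ρ < ∞)
    {s : TimeInterval T} (h0 : ∫⁻ x : PathSpace T, edist (x s) x₀ ^ p ∂ρ < ∞) :
    MemSobolevPp α p fun t => ρ.map fun x : PathSpace T => x t := by
  have hp0 : 0 < p := by linarith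
  refine ⟨memPp_map_eval hp hH h0, measurable_map_eval, ?_⟩
  rw [← ENNReal.rpow_lt_top_iff_of_pos hp0]
  exact (sobolevSeminorm_rpow_le_lintegral (Y := id) hp0 measurable_id
    (wasserstein_map_eval_le hp0) α).trans_lt hS

end Marginals

/-! ### Random measures -/

theorem map_quantileVersion_eq {Ω : Type*} {μ ν : Ω → Measure ℝ} {ω : Ω} (hμ : IsProbabilityMeasure (μ ω))
    (hν : IsProbabilityMeasure (ν ω)) :
    unitMeasure.map (fun q => (quantileVersion μ (ω, q), quantileVersion ν (ω, q))) =
      quantileCoupling (μ ω) (ν ω) :=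
  Measure.map_congr ((quantileVersion_ae_eq μ hμ).prodMk (quantileVersion_ae_eq ν hν))

section RandomMeasures

variable {Ω : Type*} [MeasurableSpace Ω]

theorem measurable_map_unitMeasure {E : Type*} [MeasurableSpace E] {f : Ω × ℝ → E}
    (hf : Measurable f) : Measurable fun ω => unitMeasure.map fun q => f (ω, q) := by
  refine Measure.measurable_of_measurable_coe _ fun s hs => ?_
  have h : ∀ ω, unitMeasure.map (fun q => f (ω, q)) s = unitMeasure (Prod.mk ω ⁻¹' (f ⁻¹' s)) :=
    fun ω => Measure.map_apply (hf.comp measurable_prodMk_left) hs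
  simp_rw [h]
  exact measurable_measure_prodMk_left (hf hs)

theorem isRandomProb_map_unitMeasure (P : Measure Ω) {E : Type*} [MeasurableSpace E]
    {f : Ω × ℝ → E} (hf : Measurable f) :
    IsRandomProb P fun ω => unitMeasure.map fun q => f (ω, q) :=
  ⟨measurable_map_unitMeasure hf, ae_of_all _ fun _ =>
    Measure.isProbabilityMeasure_map (hf.comp measurable_prodMk_left).aemeasurable⟩

theorem lintegral_map_unitMeasure {P : Measure Ω} {E : Type*} [MeasurableSpace E]
    {f : Ω × ℝ → E} (hf : Measurable f) {F : E → ℝ≥0∞} (hF : Measurable F) :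
    ∫⁻ ω, ∫⁻ x, F x ∂(unitMeasure.map fun q => f (ω, q)) ∂P =
      ∫⁻ z, F (f z) ∂(P.prod unitMeasure) := by
  rw [lintegral_prod (fun z => F (f z)) (hF.comp hf).aemeasurable]
  exact lintegral_congr fun ω => lintegral_map hF (hf.comp measurable_prodMk_left)

/-- The fibrewise monotone coupling is already a random coupling, so no measurable selection of
optimizers is needed; conversely every random coupling costs at least as much for almost every `ω`.
-/
theorem randomWasserstein_eq {P : Measure Ω} {p : ℝ} (hp : 1 < p) {μ ν : Ω → Measure ℝ}
    (hμ : IsRandomProb P μ) (hν : IsRandomProb P ν) :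
    randomWasserstein P p μ ν =
      (∫⁻ z, edist (quantileVersion μ z) (quantileVersion ν z) ^ p ∂(P.prod unitMeasure)) ^
        (1 / p) := by
  have hf : Measurable fun z : Ω × ℝ => (quantileVersion μ z, quantileVersion ν z) :=
    (measurable_quantileVersion hμ.1).prodMk (measurable_quantileVersion hν.1)
  have hcost := lintegral_map_unitMeasure (P := P) hf
    (F := fun z : ℝ × ℝ => edist z.1 z.2 ^ p) (by fun_prop)
  have hcpl : IsRandomCoupling P (fun ω => unitMeasure.map fun q =>
      (quantileVersion μ (ω, q), quantileVersion ν (ω, q))) μ ν := by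
    refine ⟨isRandomProb_map_unitMeasure P hf, ?_⟩
    filter_upwards [hμ.2, hν.2] with ω h1 h2
    rw [map_quantileVersion_eq h1 h2]
    exact isCoupling_quantileCoupling _ _
  rw [randomWasserstein]
  congr 1
  refine le_antisymm (iInf₂_le_of_le _ hcpl hcost.le) (le_iInf₂ fun Υ hΥ => ?_)
  rw [← hcost]
  refine lintegral_mono_ae ?_
  filter_upwards [hμ.2, hν.2, hΥ.2] with ω h1 h2 h3
  rw [map_quantileVersion_eq h1 h2]
  exact (isOptCoupling_quantileCoupling hp _ _).2 _ h3

end RandomMeasures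

/-! ### The quantile lift -/

/-- A constant `c` with `c * (A * M) ≤ M`, where `A` is the constant in the Kolmogorov estimate. -/
noncomputable def liftConst (T p κ α : ℝ) : ℝ :=
  -- The added `1` avoids division by zero should the Kolmogorov constant vanish.
  1 / ((chainingConst T (α - 1 / p) ^ p * energyConst T p κ (α - 1 / p)).toReal + 1)

theorem liftConst_pos (T p κ α : ℝ) : 0 < liftConst T p κ α :=
  one_div_pos.2 (add_pos_of_nonneg_of_pos ENNReal.toReal_nonneg one_pos)

theorem kolmogorovConst_ne_top {T p κ α : ℝ} (hT : 0 < T) (hp : 0 < p) (hα : α ∈ Ioo (1 / p) κ) :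
    chainingConst T (α - 1 / p) ^ p * energyConst T p κ (α - 1 / p) ≠ ∞ :=
  ENNReal.mul_ne_top (ENNReal.rpow_ne_top_of_nonneg hp.le
    (chainingConst_ne_top T (sub_pos.2 hα.1)))
    (energyConst_ne_top hT hp (by linarith [hα.2]))

theorem liftConst_mul_le {T p κ α : ℝ} (hT : 0 < T) (hp : 0 < p) (hα : α ∈ Ioo (1 / p) κ) :
    ENNReal.ofReal (liftConst T p κ α) *
      (chainingConst T (α - 1 / p) ^ p * energyConst T p κ (α - 1 / p)) ≤ 1 := by
  have h := kolmogorovConst_ne_top hT hp hα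
  rw [liftConst]
  set A := chainingConst T (α - 1 / p) ^ p * energyConst T p κ (α - 1 / p)
  have hA : 0 ≤ A.toReal := ENNReal.toReal_nonneg
  rw [← ENNReal.ofReal_toReal h, ← ENNReal.ofReal_mul (by positivity), ENNReal.toReal_ofReal hA,
    ENNReal.ofReal_le_one, one_div, inv_mul_le_one₀ (by positivity)]
  linarith

end QuantileLift

open QuantileLift in
theorem corollary1p5 {T p κ : ℝ} (hT : 0 < T) (hp : 1 < p) (hκ : 1 / p < κ) (hκ_le : κ ≤ 1) :
    -- the constant, a function of `α` for given `κ, p, T`, is chosen before the process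
    ∃ c : ℝ → ℝ, (∀ α ∈ Ioo (1 / p) κ, 0 < c α) ∧
      ∀ (Ω : Type u) [MeasurableSpace Ω] (P : Measure Ω) [IsProbabilityMeasure P]
        (μ : TimeInterval T → Ω → Measure ℝ), MemHolderPpΩ P κ p μ →
        ∃ π : Ω → Measure (PathSpace T), IsRandomProb P π ∧
          -- finite-dimensional marginals
          (∀ (j : ℕ) (t : Fin j → TimeInterval T), ∀ᵐ ω ∂P,
            (π ω).map (fun (x : PathSpace T) i => x (t i)) =
              (volume.restrict (Icc (0 : ℝ) 1)).map (fun q i => quantile (μ (t i) ω) q)) ∧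
          -- (i) regularity of the paths and of the curve of marginals
          (∀ α ∈ Ioo (1 / p) κ, ∀ᵐ ω ∂P,
            (∀ᵐ (x : PathSpace T) ∂(π ω), sobolevSeminorm edist α p ⇑x < ∞ ∧
              holderSeminorm edist (α - 1 / p) ⇑x < ∞) ∧
            MemSobolevPp α p (fun t => (π ω).map (fun (x : PathSpace T) => x t)) ∧
            MemHolderPp (α - 1 / p) p (fun t => (π ω).map (fun (x : PathSpace T) => x t))) ∧
          -- (ii) `π` is a random lift
          (∀ t : TimeInterval T, ∀ᵐ ω ∂P, (π ω).map (fun (x : PathSpace T) => x t) = μ t ω) ∧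
          -- (iii) optimality and energies
          (∀ s t : TimeInterval T, ∀ᵐ ω ∂P,
            IsOptCoupling p ((π ω).map (fun (x : PathSpace T) => (x s, x t))) (μ s ω) (μ t ω)) ∧
          (∀ α ∈ Ioo (1 / p) κ,
            sobolevSeminorm (randomWasserstein P p) α p μ ^ p =
              ∫⁻ ω, ∫⁻ x : PathSpace T, sobolevSeminorm edist α p ⇑x ^ p ∂(π ω) ∂P) ∧
          (∀ α ∈ Ioo (1 / p) κ,
            ENNReal.ofReal (c α) * ∫⁻ ω, ∫⁻ x : PathSpace T, holderSeminorm edist (α - 1 / p) ⇑x ^ p ∂(π ω) ∂P ≤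
              holderSeminorm (randomWasserstein P p) κ μ ^ p ∧
            ENNReal.ofReal (c α) * holderSeminorm (randomWasserstein P p) (α - 1 / p) μ ^ p ≤
              ENNReal.ofReal (c α) *
                ∫⁻ ω, ∫⁻ x : PathSpace T, holderSeminorm edist (α - 1 / p) ⇑x ^ p ∂(π ω) ∂P) := by
  have hp0 : 0 < p := by linarith
  refine ⟨liftConst T p κ, fun α _ => liftConst_pos T p κ α, fun Ω _ P _ μ hμ => ?_⟩
  obtain ⟨hPp, -, hHol⟩ := hμ
  have hprob : ∀ t, IsRandomProb P (μ t) := fun t => (hPp t).1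
  have hX : ∀ t, Measurable (quantileVersion (μ t)) := fun t =>
    measurable_quantileVersion (hprob t).1
  have hW := fun s t => randomWasserstein_eq hp (hprob s) (hprob t)
  have hWle : ∀ s t : TimeInterval T, randomWasserstein P p (μ s) (μ t) ≤
      holderSeminorm (randomWasserstein P p) κ μ * ENNReal.ofReal (|(t : ℝ) - s| ^ κ) := by
    refine le_holderSeminorm_mul κ (fun s t => ?_) fun s => ?_
    · simp_rw [hW, edist_comm]
    · simp [hW, hp0]
  -- Here `q` is part of the randomness: the modification is made on the product space, with the
  -- Hölder seminorm of `μ` as moment constant, so `Y` is jointly measurable in `(ω, q)`.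
  obtain ⟨Y, hYm, hYX, hYH⟩ := exists_continuous_modification (Q := P.prod unitMeasure) hT hp0 hκ
    hHol.ne hX fun s t => by
      rw [← ENNReal.rpow_inv_le_iff hp0, ← one_div, ← hW]
      exact hWle s t
  have hYW : ∀ s t, randomWasserstein P p (μ s) (μ t) =
      (∫⁻ z, edist (Y z s) (Y z t) ^ p ∂(P.prod unitMeasure)) ^ (1 / p) := by
    intro s t
    rw [hW]
    congr 1
    refine lintegral_congr_ae ?_
    filter_upwards [hYX s, hYX t] with z h1 h2
    rw [h1, h2]
  -- Fubini turns the product null set into null sets of `q` for almost every `ω`; the exceptional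
  -- set of `ω` depends on `t`.
  have hYq : ∀ t, ∀ᵐ ω ∂P, ∀ᵐ q ∂unitMeasure, Y (ω, q) t = quantile (μ t ω) q := by
    intro t
    filter_upwards [Measure.ae_ae_of_ae_prod (hYX t), (hprob t).2] with ω h1 h2
    filter_upwards [h1, quantileVersion_ae_eq (μ t) h2] with q h3 h4
    rw [h3]
    exact h4
  have hYω : ∀ ω, Measurable fun q => Y (ω, q) := fun ω => hYm.comp measurable_prodMk_left
  set π : Ω → Measure (PathSpace T) := fun ω => unitMeasure.map fun q => Y (ω, q) with hπ
  have hπprob : ∀ ω, IsProbabilityMeasure (π ω) := fun ω =>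
    Measure.isProbabilityMeasure_map (hYω ω).aemeasurable
  have hπm : Measurable π := measurable_map_unitMeasure hYm
  have hπF : ∀ {F : PathSpace T → ℝ≥0∞}, Measurable F →
      ∫⁻ ω, ∫⁻ x, F x ∂(π ω) ∂P = ∫⁻ z, F (Y z) ∂(P.prod unitMeasure) := fun hF =>
    lintegral_map_unitMeasure hYm hF
  have hae : ∀ {F : PathSpace T → ℝ≥0∞}, Measurable F →
      ∫⁻ z, F (Y z) ∂(P.prod unitMeasure) < ∞ → ∀ᵐ ω ∂P, ∫⁻ x, F x ∂(π ω) < ∞ := by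
    intro F hF h
    rw [← hπF hF] at h
    exact ae_lt_top ((Measure.measurable_lintegral hF).comp hπm) h.ne
  have hmH : ∀ θ, Measurable fun x : PathSpace T => holderSeminorm edist θ x ^ p := fun θ =>
    (measurable_holderSeminorm θ).pow_const p
  have hmS : ∀ α, Measurable fun x : PathSpace T => sobolevSeminorm edist α p x ^ p := fun α =>
    (measurable_sobolevSeminorm α p).pow_const p
  have hS : ∀ α, sobolevSeminorm (randomWasserstein P p) α p μ ^ p =
      ∫⁻ z, sobolevSeminorm edist α p (Y z) ^ p ∂(P.prod unitMeasure) :=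
    sobolevSeminorm_rpow_eq_lintegral hp0 hYm hYW
  have hlift : ∀ t, ∀ᵐ ω ∂P, (π ω).map (fun x : PathSpace T => x t) = μ t ω := by
    intro t
    filter_upwards [hYq t, (hprob t).2] with ω h1 h2
    rw [hπ, Measure.map_map (measurable_pathSpace_eval t) (hYω ω)]
    exact (Measure.map_congr h1).trans (map_quantile (μ t ω))
  refine ⟨π, ⟨hπm, ae_of_all _ hπprob⟩, fun j t => ?_, fun α hα => ?_, hlift, fun s t => ?_,
    fun α _ => ?_, fun α hα => ?_⟩
  · filter_upwards [ae_all_iff.2 fun i => hYq (t i)] with ω h1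
    rw [hπ, Measure.map_map (measurable_pi_lambda _ fun i => measurable_pathSpace_eval (t i))
      (hYω ω)]
    refine Measure.map_congr ?_
    filter_upwards [ae_all_iff.2 h1] with q hq
    exact funext hq
  · have hθ : 0 < α - 1 / p := sub_pos.2 hα.1
    have hHfin := (hYH (α - 1 / p) hθ (by linarith [hα.2])).trans_lt (ENNReal.mul_lt_top
      (kolmogorovConst_ne_top hT hp0 hα).lt_top (ENNReal.rpow_lt_top_of_nonneg hp0.le hHol.ne))
    have hSfin := sobolevSeminorm_lt_top_of_le (α := α) hT.le hp0 hα.2 hHol.ne hWle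
      fun s => by simp [hW, hp0]
    rw [hS] at hSfin
    -- The moment of `μ` is used at the single time `0`; `memPp_map_eval` then covers all times off
    -- one null set of `ω`.
    set t₀ : TimeInterval T := ⟨0, le_rfl, hT.le⟩
    obtain ⟨x₀, hx₀⟩ := (hPp t₀).2
    have hx₀' := ae_lt_top ((Measure.measurable_lintegral
      (f := fun x : ℝ => edist x x₀ ^ p) (by fun_prop)).comp (hprob t₀).1) hx₀.ne
    filter_upwards [hae (hmH _) hHfin, hae (hmS α) hSfin, hx₀', hlift t₀] with ω h1 h2 h3 h4
    have h0 : ∫⁻ x : PathSpace T, edist (x t₀) x₀ ^ p ∂(π ω) < ∞ := by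
      rw [Function.comp_apply, ← h4, lintegral_map (by fun_prop) (measurable_pathSpace_eval t₀)] at h3
      exact h3
    refine ⟨?_, memSobolevPp_map_eval hp.le h2 h1 h0, memHolderPp_map_eval hp.le hθ h1 h0⟩
    filter_upwards [ae_lt_top (hmH _) h1.ne, ae_lt_top (hmS α) h2.ne] with x hx1 hx2
    exact ⟨(ENNReal.rpow_lt_top_iff_of_pos hp0).1 hx2, (ENNReal.rpow_lt_top_iff_of_pos hp0).1 hx1⟩
  · filter_upwards [hYq s, hYq t, (hprob s).2, (hprob t).2] with ω h1 h2 h3 h4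
    rw [hπ, Measure.map_map ((measurable_pathSpace_eval s).prodMk (measurable_pathSpace_eval t))
      (hYω ω)]
    have h : unitMeasure.map ((fun x : PathSpace T => (x s, x t)) ∘ fun q => Y (ω, q)) =
        quantileCoupling (μ s ω) (μ t ω) :=
      Measure.map_congr (EventuallyEq.prodMk h1 h2)
    rw [h]
    exact isOptCoupling_quantileCoupling hp _ _
  · rw [hS, hπF (hmS α)]
  · rw [hπF (hmH _)]
    refine ⟨?_, mul_le_mul_right (holderSeminorm_rpow_le_lintegral hp0 (fun s t => (hYW s t).le) _) _⟩
    refine (mul_le_mul_right (hYH (α - 1 / p) (sub_pos.2 hα.1) (by linarith [hα.2])) _).trans ?_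
    rw [← mul_assoc]
    exact (mul_le_mul_left (liftConst_mul_le hT hp0 hα) _).trans (one_mul _).le
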